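/- **Formulas.** Fix a set $\mathsf{Prop}$ of propositional variables. Classical formulas are $\alpha ::= p\mid\bot\mid\top\mid\neg\alpha\mid\alpha\wedge\alpha\mid\alpha\vee\alpha$. Formulas of propositional inclusion logic $\mathbf{CPL}(\subseteq)$ are $$\phi ::= p\mid\bot\mid\top\mid\neg\alpha\mid\phi\wedge\phi\mid\phi\vee\phi\mid a_1\dots a_k\subseteq b_1\dots b_k\qquad(k\ge 0),$$ with $\alpha$ classical and $a_i,b_i\in\mathsf{Prop}\cup\{\top,\bot\}$. An inclusion atom is primitive if it has the form $\mathsf x\subseteq\mathsf a$ with $\mathsf x\in\{\top,\bot\}^k$; formulas in which all inclusion atoms are primitive form $\mathbf{CPL}(\subseteq_0)$. Write $\alpha\to\phi:=\neg\alpha\vee\phi$; $p^\top:=p$, $p^\bot:=\neg p$, $\top^\top=\bot^\bot:=\top$, $\top^\bot=\bot^\top:=\bot$; and $\mathsf a^{\mathsf x}:=a_1^{x_1}\wedge\dots\wedge a_k^{x_k}$ (empty conjunctions are $\top$). **Semantics.** A team $X$ with domain $\mathsf N\subseteq\mathsf{Prop}$ is a set of valuations $v:\mathsf N\to\{0,1\}$,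 extended by $v(\bot)=0$, $v(\top)=1$. Define: $X\models p$ iff $v(p)=1$ for all $v\in X$; $X\models\bot$ iff $X=\emptyset$; $X\models\top$ always; $X\models\neg\alpha$ iff $\{v\}\not\models\alpha$ for all $v\in X$; $X\models\phi\wedge\psi$ iff $X\models\phi$ and $X\models\psi$; $X\models\phi\vee\psi$ iff $X=Y\cup Z$ for some $Y,Z\subseteq X$ with $Y\models\phi$ and $Z\models\psi$; $X\models\mathsf a\subseteq\mathsf b$ iff for every $v\in X$ there is $u\in X$ with $v(\mathsf a)=u(\mathsf b)$. $\Gamma\models\phi$ means that every team whose domain contains all variables of $\Gamma\cup\{\phi\}$ and which satisfies all of $\Gamma$ satisfies $\phi$; $\phi\equiv\psi$ means $\{\phi\}\models\psi$ and $\{\psi\}\models\phi$. **Deduction system.** $\Gamma\vdash\phi$ means that there is a natural deduction derivation of $\phi$ with undischarged assumptions in $\Gamma$, using the following rules, where $\alpha$ is classical, $\phi,\psi,\chi$ are arbitrary formulas, $\mathsf a,\mathsf b,\dots$ are arbitrary, possibly empty sequences of elements of $\mathsf{Prop}\cup\{\top,\bot\}$ (of matching lengths), and $\mathsf x,\mathsf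 x_i$ are sequences of constants. *Classical rules:* $\top$; $\phi,\psi\,/\,\phi\wedge\psi$; $\phi\wedge\psi\,/\,\phi$; $\phi\wedge\psi\,/\,\psi$; $\phi\,/\,\phi\vee\psi$; $\phi\,/\,\psi\vee\phi$; $\alpha,\neg\alpha\,/\,\phi$; from a derivation of $\bot$ from $[\alpha]$ infer $\neg\alpha$; from a derivation of $\bot$ from $[\neg\alpha]$ infer $\alpha$; from $\phi\vee\psi$ and derivations of $\chi$ from $[\phi]$ and of $\chi$ from $[\psi]$ infer $\chi$. In the last three rules the undischarged assumptions of the subderivations must be classical. *Further rules of the $\mathbf{CPL}(\subseteq_0)$ system:* - $\mathsf{abc}\subseteq\mathsf{a'b'c'}\,/\,\mathsf{bac}\subseteq\mathsf{b'a'c'}$; $\ \mathsf{ab}\subseteq\mathsf{cd}\,/\,\mathsf a\subseteq\mathsf c$; $\ \mathsf{ab}\subseteq\mathsf{cd}\,/\,\mathsf{aab}\subseteq\mathsf{ccd}$; $\ \mathsf a\subseteq\mathsf b,\ \mathsf b\subseteq\mathsf c\,/\,\mathsf a\subseteq\mathsf c$; $\ \mathsf a\subseteq\mathsf a$ (no premise);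 - $\mathsf a\subseteq\mathsf b,\ \alpha(\mathsf b)\,/\,\alpha(\mathsf a)$, where $\alpha(\cdot)$ is a classical template without constants, built from $k=|\mathsf a|=|\mathsf b|$ places that are filled with the entries of $\mathsf b$, respectively $\mathsf a$; - $\mathsf a\subseteq\mathsf b\,/\,\top\mathsf a\subseteq\top\mathsf b$; $\ \mathsf a\subseteq\mathsf b\,/\,\bot\mathsf a\subseteq\bot\mathsf b$; $\ p,\ \mathsf a\subseteq\mathsf b\,/\,\top\mathsf a\subseteq p\mathsf b$; $\ \neg p,\ \mathsf a\subseteq\mathsf b\,/\,\bot\mathsf a\subseteq p\mathsf b$; - from $(\phi\wedge\mathsf x\subseteq\mathsf a)\vee\psi$ and derivations of $\chi$ from $[\phi],[\mathsf x\subseteq\mathsf a]$, of $\chi$ from $[\psi]$, and of $\chi$ from $[\phi\vee\psi],[\mathsf x\subseteq\mathsf a]$, infer $\chi$; - from $\phi\vee\psi$ and $\mathsf x_1\subseteq\mathsf a_1,\dots,\mathsf x_k\subseteq\mathsf a_k$ infer $\big((\phi\vee\mathsf a_1^{\mathsf x_1}\vee\dots\vee\mathsf a_k^{\mathsf x_k})\wedge\mathsf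 x_1\subseteq\mathsf a_1\wedge\dots\wedge\mathsf x_k\subseteq\mathsf a_k\big)\vee\psi$. *The two rules added for $\mathbf{CPL}(\subseteq)$:* - ($\subseteq$Ext) from $\bigwedge_{\mathsf x\in\{\top,\bot\}^{|\mathsf a|}}(\mathsf a^{\mathsf x}\to\mathsf x\subseteq\mathsf b)$ infer $\mathsf a\subseteq\mathsf b$; - ($\subseteq$Rdt) from $\mathsf a\subseteq\mathsf b$ infer $\mathsf a^{\mathsf x}\to\mathsf x\subseteq\mathsf b$, for any $\mathsf x\in\{\top,\bot\}^{|\mathsf a|}$. **Theorem.** (1) (Soundness and completeness) For every set $\Gamma\cup\{\phi\}$ of $\mathbf{CPL}(\subseteq)$-formulas, $\Gamma\models\phi$ if and only if $\Gamma\vdash\phi$. (2) For all sequences $\mathsf a,\mathsf b$ of the same length of elements of $\mathsf{Prop}\cup\{\top,\bot\}$, the formula $\bigwedge_{\mathsf x\in\{\top,\bot\}^{|\mathsf a|}}(\mathsf a^{\mathsf x}\to\mathsf x\subseteq\mathsf b)$ is a $\mathbf{CPL}(\subseteq_0)$-formula, and it is equivalent to $\mathsf a\subseteq\mathsf b$ both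 semantically and provably: $$\mathsf a\subseteq\mathsf b\;\equiv\;\bigwedge_{\mathsf x}(\mathsf a^{\mathsf x}\to\mathsf x\subseteq\mathsf b)\qquad\text{and}\qquad \mathsf a\subseteq\mathsf b\;\dashv\vdash\;\bigwedge_{\mathsf x}(\mathsf a^{\mathsf x}\to\mathsf x\subseteq\mathsf b).$$ -/

import Mathlib

namespace InclLogic

/-- The arguments of inclusion atoms: propositional variables and the two constants. -/
inductive Arg (V : Type*) where
  | var (p : V)
  | top
  | bot

/-- Classical formulas: `p | ⊥ | ⊤ | ¬α | α ∧ α | α ∨ α`. -/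
inductive CForm (V : Type*) where
  | var (p : V)
  | bot
  | top
  | neg (α : CForm V)
  | and (α β : CForm V)
  | or (α β : CForm V)

/-- Formulas of propositional inclusion logic `CPL(⊆)`:
`p | ⊥ | ⊤ | ¬α | φ ∧ φ | φ ∨ φ | a₁ … a_k ⊆ b₁ … b_k`, where `α` is classical and `k ≥ 0`. -/
inductive Form (V : Type*) where
  | var (p : V)
  | bot
  | top
  | neg (α : CForm V)
  | and (φ ψ : Form V)
  | or (φ ψ : Form V)
  | incl {k : ℕ} (a b : Fin k → Arg V)

section Formulas

variable {V : Type*}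

/-- The constant `⊤` or `⊥` named by a truth value. -/
def Arg.const : Bool → Arg V
  | true => .top
  | false => .bot

/-- An argument as a classical formula. -/
def Arg.toCForm : Arg V → CForm V
  | .var p => .var p
  | .top => .top
  | .bot => .bot

/-- Classical formulas as formulas of `CPL(⊆)`. -/
def CForm.toForm : CForm V → Form V
  | .var p => .var p
  | .bot => .bot
  | .top => .top
  | .neg α => .neg α
  | .and α β => .and α.toForm β.toForm
  | .or α β => .or α.toForm β.toForm

/-- `φ` is a classical formula. -/
def Form.IsClassical (φ : Form V) : Prop := ∃ α : CForm V, φ = α.toForm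

/-- Finite conjunctions of classical formulas; the empty one is `⊤`. -/
def CForm.conj : List (CForm V) → CForm V
  | [] => .top
  | [α] => α
  | α :: β :: l => .and α (CForm.conj (β :: l))

/-- Finite conjunctions of formulas; the empty one is `⊤`. -/
def Form.conj : List (Form V) → Form V
  | [] => .top
  | [φ] => φ
  | φ :: ψ :: l => .and φ (Form.conj (ψ :: l))

/-- The implication `α → φ := ¬α ∨ φ`, for a classical `α`. -/
def Form.imp (α : CForm V) (φ : Form V) : Form V := .or (.neg α) φ

/-- `a ^ x`: `p ^ ⊤ = p`, `p ^ ⊥ = ¬p`, `⊤ ^ ⊤ = ⊥ ^ ⊥ = ⊤`, `⊤ ^ ⊥ = ⊥ ^ ⊤ = ⊥`. -/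
def Arg.pow : Arg V → Bool → CForm V
  | .var p, true => .var p
  | .var p, false => .neg (.var p)
  | .top, true => .top
  | .top, false => .bot
  | .bot, true => .bot
  | .bot, false => .top

/-- For sequences, `a ^ x := a₁ ^ x₁ ∧ ⋯ ∧ a_k ^ x_k`. -/
def seqPow {k : ℕ} (a : Fin k → Arg V) (x : Fin k → Bool) : CForm V :=
  CForm.conj (List.ofFn fun i => (a i).pow (x i))

/-- The primitive inclusion atom `x ⊆ a`, where `x` is a sequence of constants. -/
def Form.primIncl {k : ℕ} (x : Fin k → Bool) (a : Fin k → Arg V) : Form V :=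
  .incl (fun i => Arg.const (x i)) a

/-- All inclusion atoms of the formula are primitive, i.e. it is a formula of `CPL(⊆₀)`. -/
def Form.IsPrimitive : Form V → Prop
  | .var _ => True
  | .bot => True
  | .top => True
  | .neg _ => True
  | .and φ ψ => φ.IsPrimitive ∧ ψ.IsPrimitive
  | .or φ ψ => φ.IsPrimitive ∧ ψ.IsPrimitive
  | .incl (k := k) a _ => ∃ x : Fin k → Bool, a = fun i => Arg.const (x i)

/-- The list of all sequences of constants of length `k`. -/
def allConsts : (k : ℕ) → List (Fin k → Bool)
  | 0 => [Fin.elim0]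
  | k + 1 => (allConsts k).map (Fin.cons true) ++ (allConsts k).map (Fin.cons false)

theorem mem_allConsts : ∀ {k : ℕ} (x : Fin k → Bool), x ∈ allConsts k
  | 0, x => by
    simp only [allConsts, List.mem_singleton]
    exact Subsingleton.elim _ _
  | k + 1, x => by
    have h := mem_allConsts (Fin.tail x)
    simp only [allConsts, List.mem_append, List.mem_map]
    cases hx : x 0 with
    | true => exact Or.inl ⟨_, h, by rw [← hx]; exact Fin.cons_self_tail x⟩
    | false => exact Or.inr ⟨_, h, by rw [← hx]; exact Fin.cons_self_tail x⟩

/-- The conjunction of all formulas `a ^ x → x ⊆ b`, for `x` a sequence of constants. -/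
def Form.reduct {k : ℕ} (a b : Fin k → Arg V) : Form V :=
  Form.conj ((allConsts k).map fun x => Form.imp (seqPow a x) (Form.primIncl x b))

/-- Simultaneous replacement of variables by arguments. -/
def CForm.subst {W : Type*} (s : W → Arg V) : CForm W → CForm V
  | .var i => (s i).toCForm
  | .bot => .bot
  | .top => .top
  | .neg α => .neg (α.subst s)
  | .and α β => .and (α.subst s) (β.subst s)
  | .or α β => .or (α.subst s) (β.subst s)

/-- The formula contains no constant symbols. -/
def CForm.ConstFree : CForm V → Prop
  | .var _ => True
  | .bot => False
  | .top => False
  | .neg α => α.ConstFree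
  | .and α β => α.ConstFree ∧ β.ConstFree
  | .or α β => α.ConstFree ∧ β.ConstFree

/-- The variables occurring in an argument. -/
def Arg.vars : Arg V → Set V
  | .var p => {p}
  | .top => ∅
  | .bot => ∅

/-- The variables occurring in a classical formula. -/
def CForm.vars : CForm V → Set V
  | .var p => {p}
  | .bot => ∅
  | .top => ∅
  | .neg α => α.vars
  | .and α β => α.vars ∪ β.vars
  | .or α β => α.vars ∪ β.vars

/-- The variables occurring in a formula. -/
def Form.vars : Form V → Set V
  | .var p => {p}
  | .bot => ∅
  | .top => ∅
  | .neg α => α.vars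
  | .and φ ψ => φ.vars ∪ ψ.vars
  | .or φ ψ => φ.vars ∪ ψ.vars
  | .incl a b => (⋃ i, (a i).vars) ∪ ⋃ i, (b i).vars

end Formulas

section Semantics

variable {V : Type*}

/-- A valuation with domain `N`. -/
abbrev Valuation (N : Set V) := N → Bool

/-- A team with domain `N`. -/
abbrev Team (N : Set V) := Set (Valuation N)

open Classical in
/-- The value of an argument. Variables outside the domain get the value `false`;
this is never used for the formulas in an entailment, whose variables all lie in the domain. -/
noncomputable def Arg.val {N : Set V} (v : Valuation N) : Arg V → Bool
  | .var p => if h : p ∈ N then v ⟨p, h⟩ else false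
  | .top => true
  | .bot => false

/-- Team semantics of classical formulas. -/
def CForm.Sat {N : Set V} (X : Team N) : CForm V → Prop
  | .var p => ∀ v ∈ X, (Arg.var p).val v = true
  | .bot => X = ∅
  | .top => True
  | .neg α => ∀ v ∈ X, ¬ CForm.Sat {v} α
  | .and α β => CForm.Sat X α ∧ CForm.Sat X β
  | .or α β => ∃ Y Z : Team N, Y ⊆ X ∧ Z ⊆ X ∧ X = Y ∪ Z ∧ CForm.Sat Y α ∧ CForm.Sat Z β

/-- Team semantics of `CPL(⊆)` (lax semantics). -/
def Form.Sat {N : Set V} (X : Team N) : Form V → Prop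
  | .var p => ∀ v ∈ X, (Arg.var p).val v = true
  | .bot => X = ∅
  | .top => True
  | .neg α => ∀ v ∈ X, ¬ CForm.Sat {v} α
  | .and φ ψ => Form.Sat X φ ∧ Form.Sat X ψ
  | .or φ ψ => ∃ Y Z : Team N, Y ⊆ X ∧ Z ⊆ X ∧ X = Y ∪ Z ∧ Form.Sat Y φ ∧ Form.Sat Z ψ
  | .incl a b => ∀ v ∈ X, ∃ u ∈ X, ∀ i, (a i).val v = (b i).val u

/-- `Γ ⊨ φ`: every team whose domain contains all variables of `Γ` and `φ`
and which satisfies all formulas of `Γ` satisfies `φ`. -/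
def Entails (Γ : Set (Form V)) (φ : Form V) : Prop :=
  ∀ N : Set V, (⋃ γ ∈ Γ, γ.vars) ∪ φ.vars ⊆ N →
    ∀ X : Team N, (∀ γ ∈ Γ, γ.Sat X) → φ.Sat X

/-- Semantic equivalence. -/
def SemEquiv (φ ψ : Form V) : Prop := Entails {φ} ψ ∧ Entails {ψ} φ

end Semantics

section Derivations

variable {V : Type*}

/-- A primitive inclusion atom `x ⊆ a`, as data. -/
structure PrimAtom (V : Type*) where
  len : ℕ
  x : Fin len → Bool
  a : Fin len → Arg V

/-- The formula `x ⊆ a`. -/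
def PrimAtom.toForm (P : PrimAtom V) : Form V := Form.primIncl P.x P.a

/-- The formula `a ^ x`. -/
def PrimAtom.power (P : PrimAtom V) : CForm V := seqPow P.a P.x

/-- The formula
`((φ ∨ a₁ ^ x₁ ∨ ⋯ ∨ a_k ^ x_k) ∧ x₁ ⊆ a₁ ∧ ⋯ ∧ x_k ⊆ a_k) ∨ ψ`. -/
def Form.dst (φ ψ : Form V) (L : List (PrimAtom V)) : Form V :=
  .or
    (L.foldl (fun χ P => .and χ P.toForm)
      (L.foldl (fun χ P => .or χ P.power.toForm) φ))
    ψ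

/-- Natural deduction for `CPL(⊆)`. `Derives Γ φ` says that there is a derivation of `φ` whose
undischarged assumptions belong to `Γ`. In the rules with a side condition, `Δ` contains the
undischarged assumptions of the subderivation; these have to be classical. -/
inductive Derives : Set (Form V) → Form V → Prop
  | assumption {Γ : Set (Form V)} {φ : Form V} : φ ∈ Γ → Derives Γ φ
  -- rules for constants and classical connectives
  | topI {Γ : Set (Form V)} : Derives Γ .top
  | negI {Γ Δ : Set (Form V)} {α : CForm V} :
      Δ ⊆ Γ → (∀ δ ∈ Δ, δ.IsClassical) →
      Derives (insert α.toForm Δ) .bot → Derives Γ (.neg α)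
  | negE {Γ : Set (Form V)} {α : CForm V} {φ : Form V} :
      Derives Γ α.toForm → Derives Γ (.neg α) → Derives Γ φ
  | raa {Γ Δ : Set (Form V)} {α : CForm V} :
      Δ ⊆ Γ → (∀ δ ∈ Δ, δ.IsClassical) →
      Derives (insert (.neg α) Δ) .bot → Derives Γ α.toForm
  | andI {Γ : Set (Form V)} {φ ψ : Form V} :
      Derives Γ φ → Derives Γ ψ → Derives Γ (.and φ ψ)
  | andE₁ {Γ : Set (Form V)} {φ ψ : Form V} : Derives Γ (.and φ ψ) → Derives Γ φ
  | andE₂ {Γ : Set (Form V)} {φ ψ : Form V} : Derives Γ (.and φ ψ) → Derives Γ ψ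
  | orI₁ {Γ : Set (Form V)} {φ ψ : Form V} : Derives Γ φ → Derives Γ (.or φ ψ)
  | orI₂ {Γ : Set (Form V)} {φ ψ : Form V} : Derives Γ φ → Derives Γ (.or ψ φ)
  | orE {Γ Δ₀ Δ₁ : Set (Form V)} {φ ψ χ : Form V} :
      Δ₀ ⊆ Γ → (∀ δ ∈ Δ₀, δ.IsClassical) → Δ₁ ⊆ Γ → (∀ δ ∈ Δ₁, δ.IsClassical) →
      Derives Γ (.or φ ψ) → Derives (insert φ Δ₀) χ → Derives (insert ψ Δ₁) χ →
      Derives Γ χ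
  -- rules for inclusion atoms, shared with `CPL(⊆₀)`
  | inclExc {Γ : Set (Form V)} {l m n : ℕ} {a a' : Fin l → Arg V} {b b' : Fin m → Arg V}
      {c c' : Fin n → Arg V} :
      Derives Γ (.incl (Fin.append (Fin.append a b) c) (Fin.append (Fin.append a' b') c')) →
      Derives Γ (.incl (Fin.append (Fin.append b a) c) (Fin.append (Fin.append b' a') c'))
  | inclCtr {Γ : Set (Form V)} {m n : ℕ} {a c : Fin m → Arg V} {b d : Fin n → Arg V} :
      Derives Γ (.incl (Fin.append a b) (Fin.append c d)) → Derives Γ (.incl a c)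
  | inclWk {Γ : Set (Form V)} {m n : ℕ} {a c : Fin m → Arg V} {b d : Fin n → Arg V} :
      Derives Γ (.incl (Fin.append a b) (Fin.append c d)) →
      Derives Γ (.incl (Fin.append (Fin.append a a) b) (Fin.append (Fin.append c c) d))
  | inclTrs {Γ : Set (Form V)} {k : ℕ} {a b c : Fin k → Arg V} :
      Derives Γ (.incl a b) → Derives Γ (.incl b c) → Derives Γ (.incl a c)
  | inclId {Γ : Set (Form V)} {k : ℕ} {a : Fin k → Arg V} : Derives Γ (.incl a a)
  /-- From `a ⊆ b` and `α(b)` infer `α(a)`. The template `α` has only the positions `1, …, k`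
  as variables and no constants, so all variables and constants of `α(b)` are among `b`. -/
  | inclCmp {Γ : Set (Form V)} {k : ℕ} {a b : Fin k → Arg V} {α : CForm (Fin k)} :
      α.ConstFree → Derives Γ (.incl a b) → Derives Γ (α.subst b).toForm →
      Derives Γ (α.subst a).toForm
  | inclExtTop {Γ : Set (Form V)} {k : ℕ} {a b : Fin k → Arg V} :
      Derives Γ (.incl a b) →
      Derives Γ (.incl (k := k + 1) (Fin.cons .top a) (Fin.cons .top b))
  | inclExtVar {Γ : Set (Form V)} {k : ℕ} {a b : Fin k → Arg V} {p : V} :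
      Derives Γ (.var p) → Derives Γ (.incl a b) →
      Derives Γ (.incl (k := k + 1) (Fin.cons .top a) (Fin.cons (.var p) b))
  | inclExtBot {Γ : Set (Form V)} {k : ℕ} {a b : Fin k → Arg V} :
      Derives Γ (.incl a b) →
      Derives Γ (.incl (k := k + 1) (Fin.cons .bot a) (Fin.cons .bot b))
  | inclExtNegVar {Γ : Set (Form V)} {k : ℕ} {a b : Fin k → Arg V} {p : V} :
      Derives Γ (.neg (.var p)) → Derives Γ (.incl a b) →
      Derives Γ (.incl (k := k + 1) (Fin.cons .bot a) (Fin.cons (.var p) b))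
  | orInclE {Γ : Set (Form V)} {k : ℕ} {x : Fin k → Bool} {a : Fin k → Arg V}
      {φ ψ χ : Form V} :
      Derives Γ (.or (.and φ (.primIncl x a)) ψ) →
      Derives (insert φ (insert (.primIncl x a) Γ)) χ →
      Derives (insert ψ Γ) χ →
      Derives (insert (.or φ ψ) (insert (.primIncl x a) Γ)) χ →
      Derives Γ χ
  | inclDst {Γ : Set (Form V)} {φ ψ : Form V} {L : List (PrimAtom V)} :
      Derives Γ (.or φ ψ) → (∀ P ∈ L, Derives Γ P.toForm) → Derives Γ (.dst φ ψ L)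
  -- the two rules added for arbitrary inclusion atoms: extension and reduction
  | inclExt {Γ : Set (Form V)} {k : ℕ} {a b : Fin k → Arg V} :
      Derives Γ (.reduct a b) → Derives Γ (.incl a b)
  | inclRdt {Γ : Set (Form V)} {k : ℕ} {a b : Fin k → Arg V} (x : Fin k → Bool) :
      Derives Γ (.incl a b) → Derives Γ (.imp (seqPow a x) (.primIncl x b))

/-- Provable equivalence. -/
def ProvEquiv (φ ψ : Form V) : Prop := Derives {φ} ψ ∧ Derives {ψ} φ

end Derivations

end InclLogic

namespace InclLogic

variable {V : Type*}

/-! ### Structural properties of derivations -/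

/-! Soundness is an induction on derivations. It rests on three semantic facts: classical formulas
are flat, the empty team satisfies every formula, and satisfaction is preserved under unions of
teams.

For completeness, first fix a finite domain. A team `X` is described by `psi X`, the disjunction
`theta X` of the characteristic formulas of its members together with one primitive inclusion atom
for each member. Three syntactic facts suffice. Whatever follows from `Γ` together with each `psi X`
follows from `Γ` (`Derives.of_psi`); if `X` satisfies `φ`, then `psi X` derives `φ`
(`derives_of_sat`); otherwise `φ` and `psi X` together derive `⊥` (`Derives.bot_of_not_sat`). So if
`Γ` entails `φ`, each `psi X` either yields `φ` or contradicts a member of `Γ`.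

The difficulty is that `∨` splits teams and is not a case distinction between them.
`Derives.psiElim` overcomes this: `orInclE` releases the atoms of one disjunct after another, and
the teams involved are merged into their union. `inclDst` performs the reverse move, and `inclExt`
assembles arbitrary inclusion atoms from primitive ones.

Arbitrary `Γ` is handled by compactness: a limit of teams along an ultrafilter obeys an analogue of
Łoś's theorem (`sat_limTeam_iff`), because a formula sees only finitely many variables and there are
finitely many teams over these. In the second claim the provable equivalence is given by `inclRdt`
and `inclExt`, and the semantic one follows by soundness. -/

theorem CForm.isClassical (α : CForm V) : α.toForm.IsClassical := ⟨α, rfl⟩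

theorem Form.isClassical_neg (α : CForm V) : (Form.neg α).IsClassical := ⟨.neg α, rfl⟩

theorem forall_insert_classical {Γ : Set (Form V)} {φ : Form V} (hφ : φ.IsClassical)
    (h : ∀ δ ∈ Γ, δ.IsClassical) : ∀ δ ∈ insert φ Γ, δ.IsClassical := by
  rintro δ (rfl | hδ)
  exacts [hφ, h δ hδ]

/-- Every formula of `Δ` is derivable from `Γ`, and the classical ones are even derivable from a
single classical member of `Γ`. -/
def Covers (Γ Δ : Set (Form V)) : Prop :=
  ∀ δ ∈ Δ, Derives Γ δ ∧ (δ.IsClassical → ∃ δ' ∈ Γ, δ'.IsClassical ∧ Derives {δ'} δ)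

theorem Derives.mono {Γ Γ' : Set (Form V)} {φ : Form V} (h : Derives Γ φ) (hΓ : Γ ⊆ Γ') :
    Derives Γ' φ := by
  induction h generalizing Γ' with
  | assumption h => exact .assumption (hΓ h)
  | topI => exact .topI
  | negI h₁ h₂ h₃ => exact .negI (h₁.trans hΓ) h₂ h₃
  | negE _ _ ih₁ ih₂ => exact .negE (ih₁ hΓ) (ih₂ hΓ)
  | raa h₁ h₂ h₃ => exact .raa (h₁.trans hΓ) h₂ h₃
  | andI _ _ ih₁ ih₂ => exact .andI (ih₁ hΓ) (ih₂ hΓ)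
  | andE₁ _ ih => exact .andE₁ (ih hΓ)
  | andE₂ _ ih => exact .andE₂ (ih hΓ)
  | orI₁ _ ih => exact .orI₁ (ih hΓ)
  | orI₂ _ ih => exact .orI₂ (ih hΓ)
  | orE h₁ h₂ h₃ h₄ _ h₅ h₆ ih => exact .orE (h₁.trans hΓ) h₂ (h₃.trans hΓ) h₄ (ih hΓ) h₅ h₆
  | inclExc _ ih => exact .inclExc (ih hΓ)
  | inclCtr _ ih => exact .inclCtr (ih hΓ)
  | inclWk _ ih => exact .inclWk (ih hΓ)
  | inclTrs _ _ ih₁ ih₂ => exact .inclTrs (ih₁ hΓ) (ih₂ hΓ)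
  | inclId => exact .inclId
  | inclCmp h _ _ ih₁ ih₂ => exact .inclCmp h (ih₁ hΓ) (ih₂ hΓ)
  | inclExtTop _ ih => exact .inclExtTop (ih hΓ)
  | inclExtVar _ _ ih₁ ih₂ => exact .inclExtVar (ih₁ hΓ) (ih₂ hΓ)
  | inclExtBot _ ih => exact .inclExtBot (ih hΓ)
  | inclExtNegVar _ _ ih₁ ih₂ => exact .inclExtNegVar (ih₁ hΓ) (ih₂ hΓ)
  | orInclE _ _ _ _ ih₁ ih₂ ih₃ ih₄ =>
    exact .orInclE (ih₁ hΓ)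
      (ih₂ (Set.insert_subset_insert (Set.insert_subset_insert hΓ)))
      (ih₃ (Set.insert_subset_insert hΓ))
      (ih₄ (Set.insert_subset_insert (Set.insert_subset_insert hΓ)))
  | inclDst _ _ ih₁ ih₂ => exact .inclDst (ih₁ hΓ) fun P hP => ih₂ P hP hΓ
  | inclExt _ ih => exact .inclExt (ih hΓ)
  | inclRdt x _ ih => exact .inclRdt x (ih hΓ)

theorem Covers.insert {Γ Δ : Set (Form V)} (h : Covers Γ Δ) (φ : Form V) :
    Covers (insert φ Γ) (insert φ Δ) := by
  rintro δ (rfl | hδ)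
  · exact ⟨.assumption (Set.mem_insert _ _), fun hc =>
      ⟨_, Set.mem_insert _ _, hc, .assumption rfl⟩⟩
  · obtain ⟨h₁, h₂⟩ := h δ hδ
    refine ⟨h₁.mono (Set.subset_insert _ _), fun hc => ?_⟩
    obtain ⟨δ', hδ', h₃⟩ := h₂ hc
    exact ⟨δ', Set.mem_insert_of_mem _ hδ', h₃⟩

/-- Under a side condition only classical assumptions may remain. Mere derivability from `Γ` would
not survive the restriction to the classical part of `Γ`; this is why `Covers` asks for a classical
source. -/
theorem Covers.classical {Γ Δ Δ₀ : Set (Form V)} (h : Covers Γ Δ) (hs : Δ₀ ⊆ Δ)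
    (hc : ∀ δ ∈ Δ₀, δ.IsClassical) : Covers {γ ∈ Γ | γ.IsClassical} Δ₀ := by
  intro δ hδ
  obtain ⟨δ', h₁, h₂, h₃⟩ := (h δ (hs hδ)).2 (hc δ hδ)
  exact ⟨h₃.mono (Set.singleton_subset_iff.2 ⟨h₁, h₂⟩), fun _ => ⟨δ', ⟨h₁, h₂⟩, h₂, h₃⟩⟩

/-- Replacement of assumptions by derivations. -/
theorem Derives.of_covers {Γ Δ : Set (Form V)} {φ : Form V} (h : Derives Δ φ)
    (hc : Covers Γ Δ) : Derives Γ φ := by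
  have hs : ∀ Γ : Set (Form V), {γ ∈ Γ | γ.IsClassical} ⊆ Γ := fun _ _ h => h.1
  have hs' : ∀ Γ : Set (Form V), ∀ δ ∈ {γ ∈ Γ | γ.IsClassical}, δ.IsClassical :=
    fun _ _ h => h.2
  induction h generalizing Γ with
  | assumption h => exact (hc _ h).1
  | topI => exact .topI
  | negI h₁ h₂ _ ih => exact .negI (hs Γ) (hs' Γ) (ih ((hc.classical h₁ h₂).insert _))
  | negE _ _ ih₁ ih₂ => exact .negE (ih₁ hc) (ih₂ hc)
  | raa h₁ h₂ _ ih => exact .raa (hs Γ) (hs' Γ) (ih ((hc.classical h₁ h₂).insert _))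
  | andI _ _ ih₁ ih₂ => exact .andI (ih₁ hc) (ih₂ hc)
  | andE₁ _ ih => exact .andE₁ (ih hc)
  | andE₂ _ ih => exact .andE₂ (ih hc)
  | orI₁ _ ih => exact .orI₁ (ih hc)
  | orI₂ _ ih => exact .orI₂ (ih hc)
  | orE h₁ h₂ h₃ h₄ _ _ _ ih ih₁ ih₂ =>
    exact .orE (hs Γ) (hs' Γ) (hs Γ) (hs' Γ) (ih hc) (ih₁ ((hc.classical h₁ h₂).insert _))
      (ih₂ ((hc.classical h₃ h₄).insert _))
  | inclExc _ ih => exact .inclExc (ih hc)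
  | inclCtr _ ih => exact .inclCtr (ih hc)
  | inclWk _ ih => exact .inclWk (ih hc)
  | inclTrs _ _ ih₁ ih₂ => exact .inclTrs (ih₁ hc) (ih₂ hc)
  | inclId => exact .inclId
  | inclCmp h _ _ ih₁ ih₂ => exact .inclCmp h (ih₁ hc) (ih₂ hc)
  | inclExtTop _ ih => exact .inclExtTop (ih hc)
  | inclExtVar _ _ ih₁ ih₂ => exact .inclExtVar (ih₁ hc) (ih₂ hc)
  | inclExtBot _ ih => exact .inclExtBot (ih hc)
  | inclExtNegVar _ _ ih₁ ih₂ => exact .inclExtNegVar (ih₁ hc) (ih₂ hc)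
  | orInclE _ _ _ _ ih₁ ih₂ ih₃ ih₄ =>
    exact .orInclE (ih₁ hc) (ih₂ ((hc.insert _).insert _)) (ih₃ (hc.insert _))
      (ih₄ ((hc.insert _).insert _))
  | inclDst _ _ ih₁ ih₂ => exact .inclDst (ih₁ hc) fun P hP => ih₂ P hP hc
  | inclExt _ ih => exact .inclExt (ih hc)
  | inclRdt x _ ih => exact .inclRdt x (ih hc)

theorem Covers.of_subset {Γ Δ : Set (Form V)} (h : Δ ⊆ Γ) : Covers Γ Δ :=
  fun _ hδ => ⟨.assumption (h hδ), fun hc => ⟨_, h hδ, hc, .assumption rfl⟩⟩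

theorem Derives.exFalso {Γ : Set (Form V)} {φ : Form V} (h : Derives Γ .bot) : Derives Γ φ :=
  .negE (α := .bot) h
    (.negI (Set.empty_subset _) (fun _ h => h.elim) (.assumption (Set.mem_insert _ _)))

/-- Cut. For a classical `φ`, which may occur in the side conditions, the assumption is introduced
with the help of the rule `orInclE` and the trivial inclusion atom of length `0`. -/
theorem Derives.cut {Γ : Set (Form V)} {φ χ : Form V} (h : Derives Γ φ)
    (h' : Derives (insert φ Γ) χ) : Derives Γ χ := by
  -- A non-classical `φ` never enters a side condition, so its derivation can simply be substituted.
  -- A classical `φ` may itself depend on non-classical assumptions and has to stay an assumption.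
  by_cases hφ : φ.IsClassical
  · obtain ⟨α, rfl⟩ := hφ
    refine .orInclE (k := 0) (x := Fin.elim0) (a := fun i => Arg.const (Fin.elim0 i))
      (φ := α.toForm) (ψ := .bot) (.orI₁ (.andI h .inclId)) ?_
      (exFalso (.assumption (Set.mem_insert _ _))) ?_
    · exact h'.mono (Set.insert_subset_insert (Set.subset_insert _ _))
    -- The third subderivation of `orInclE` offers `α ∨ ⊥` in place of `α`. This formula is
    -- classical and yields `α` by itself, as `Covers` requires.
    · have hα : Derives {Form.or α.toForm .bot} α.toForm :=
        .orE (Set.empty_subset _) (fun _ h => h.elim) (Set.empty_subset _) (fun _ h => h.elim)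
          (.assumption rfl) (.assumption (Set.mem_insert _ _))
          (exFalso (.assumption (Set.mem_insert _ _)))
      refine h'.of_covers ?_
      rintro δ (rfl | hδ)
      · exact ⟨hα.mono (Set.singleton_subset_iff.2 (Set.mem_insert _ _)), fun _ =>
          ⟨_, Set.mem_insert _ _, ⟨.or α .bot, rfl⟩, hα⟩⟩
      · exact Covers.of_subset (fun _ h => Set.mem_insert_of_mem _ (Set.mem_insert_of_mem _ h)) δ hδ
  · refine h'.of_covers ?_
    rintro δ (rfl | hδ)
    · exact ⟨h, fun hc => (hφ hc).elim⟩
    · exact Covers.of_subset subset_rfl δ hδ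

theorem Derives.trans {Γ : Set (Form V)} {φ χ : Form V} (h : Derives Γ φ)
    (h' : Derives {φ} χ) : Derives Γ χ :=
  h.cut (h'.mono (Set.singleton_subset_iff.2 (Set.mem_insert _ _)))

theorem Derives.orElim {Γ : Set (Form V)} {φ ψ χ : Form V} (h : Derives Γ (.or φ ψ))
    (h₁ : Derives {φ} χ) (h₂ : Derives {ψ} χ) : Derives Γ χ :=
  .orE (Set.empty_subset _) (fun _ h => h.elim) (Set.empty_subset _) (fun _ h => h.elim) h
    (h₁.mono (Set.singleton_subset_iff.2 (Set.mem_insert _ _)))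
    (h₂.mono (Set.singleton_subset_iff.2 (Set.mem_insert _ _)))

theorem Derives.self (φ : Form V) : Derives {φ} φ := .assumption rfl

theorem Derives.orMap {Γ : Set (Form V)} {φ ψ φ' ψ' : Form V} (h : Derives Γ (.or φ ψ))
    (h₁ : Derives {φ} φ') (h₂ : Derives {ψ} ψ') : Derives Γ (.or φ' ψ') :=
  h.orElim (.orI₁ h₁) (.orI₂ h₂)

theorem Derives.orSwap {Γ : Set (Form V)} {φ ψ : Form V} (h : Derives Γ (.or φ ψ)) :
    Derives Γ (.or ψ φ) :=
  h.orElim (.orI₂ (.self _)) (.orI₁ (.self _))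

/-- Finite disjunctions of formulas; the empty one is `⊥`. -/
def Form.disj (L : List (Form V)) : Form V := L.foldr .or .bot

theorem Derives.disjI {Γ : Set (Form V)} {L : List (Form V)} {φ : Form V} (hφ : φ ∈ L)
    (h : Derives Γ φ) : Derives Γ (.disj L) := by
  induction L with
  | nil => simp at hφ
  | cons ψ L ih =>
    rcases List.mem_cons.1 hφ with rfl | hφ
    exacts [.orI₁ h, .orI₂ (ih hφ)]

theorem Derives.disjE {Γ : Set (Form V)} {L : List (Form V)} {χ : Form V}
    (h : Derives Γ (.disj L)) (hL : ∀ φ ∈ L, Derives {φ} χ) : Derives Γ χ := by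
  induction L generalizing Γ with
  | nil => exact exFalso h
  | cons ψ L ih =>
    refine orElim (φ := ψ) (ψ := .disj L) h (hL _ (by simp)) ?_
    exact ih (.self _) fun φ hφ => hL φ (by simp [hφ])

/-! ### Completeness of the classical fragment -/

/-- The value of an argument under a total valuation. -/
def Arg.eval (f : V → Bool) : Arg V → Bool
  | .var p => f p
  | .top => true
  | .bot => false

/-- Truth of a classical formula under a total valuation. -/
def CForm.Holds (f : V → Bool) : CForm V → Prop
  | .var p => f p = true
  | .bot => False
  | .top => True
  | .neg α => ¬ α.Holds f
  | .and α β => α.Holds f ∧ β.Holds f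
  | .or α β => α.Holds f ∨ β.Holds f

theorem CForm.holds_congr {f g : V → Bool} {α : CForm V} (h : ∀ p ∈ α.vars, f p = g p) :
    α.Holds f ↔ α.Holds g := by
  induction α with
  | var p => simp [Holds, h p (by simp [vars])]
  | bot => rfl
  | top => rfl
  | neg α ih => exact not_congr (ih h)
  | and α β ih₁ ih₂ =>
    exact and_congr (ih₁ fun p hp => h p (.inl hp)) (ih₂ fun p hp => h p (.inr hp))
  | or α β ih₁ ih₂ =>
    exact or_congr (ih₁ fun p hp => h p (.inl hp)) (ih₂ fun p hp => h p (.inr hp))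

theorem CForm.finite_vars (α : CForm V) : α.vars.Finite := by
  induction α with
  | var p => exact Set.finite_singleton p
  | bot => exact Set.finite_empty
  | top => exact Set.finite_empty
  | neg α ih => exact ih
  | and α β ih₁ ih₂ => exact ih₁.union ih₂
  | or α β ih₁ ih₂ => exact ih₁.union ih₂

/-- The literals over the variables in `s` that are true under `f`. -/
def literals (f : V → Bool) (s : Set V) : Set (Form V) :=
  (fun p => ((Arg.var p).pow (f p)).toForm) '' s

theorem literals_classical (f : V → Bool) (s : Set V) : ∀ δ ∈ literals f s, δ.IsClassical := by
  rintro _ ⟨p, -, rfl⟩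
  exact CForm.isClassical _

theorem Derives.negI' {Γ : Set (Form V)} {α : CForm V} (hΓ : ∀ δ ∈ Γ, δ.IsClassical)
    (h : Derives (insert α.toForm Γ) .bot) : Derives Γ (.neg α) :=
  .negI subset_rfl hΓ h

theorem Derives.orE' {Γ : Set (Form V)} {φ ψ χ : Form V} (hΓ : ∀ δ ∈ Γ, δ.IsClassical)
    (h : Derives Γ (.or φ ψ)) (h₁ : Derives (insert φ Γ) χ) (h₂ : Derives (insert ψ Γ) χ) :
    Derives Γ χ :=
  .orE subset_rfl hΓ subset_rfl hΓ h h₁ h₂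

theorem Derives.weaken {Γ : Set (Form V)} {φ ψ : Form V} (h : Derives Γ φ) :
    Derives (insert ψ Γ) φ := h.mono (Set.subset_insert _ _)

theorem Derives.head {Γ : Set (Form V)} {φ : Form V} : Derives (insert φ Γ) φ :=
  .assumption (Set.mem_insert _ _)

/-- Kalmár's lemma: the literals decide every subformula, following the truth tables. Both halves
are proved together because negation exchanges them. -/
theorem derives_literals {f : V → Bool} {s : Set V} {α : CForm V} (hs : α.vars ⊆ s) :
    (α.Holds f → Derives (literals f s) α.toForm) ∧
    (¬ α.Holds f → Derives (literals f s) (.neg α)) := by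
  have hc := literals_classical f s
  induction α with
  | var p =>
    have hp : ((Arg.var p).pow (f p)).toForm ∈ literals f s := ⟨p, hs rfl, rfl⟩
    simp only [CForm.Holds]
    cases h : f p <;> rw [h] at hp <;> simp only [reduceCtorEq, not_true, not_false_eq_true,
      false_implies, true_implies, true_and, and_true] <;> exact .assumption hp
  | bot => exact ⟨False.elim, fun _ => .negI' hc .head⟩
  | top => exact ⟨fun _ => .topI, fun h => (h trivial).elim⟩
  | neg α ih =>
    obtain ⟨h₁, h₂⟩ := ih hs
    refine ⟨h₂, fun h => .negI' hc (.negE (h₁ (not_not.1 h)).weaken .head)⟩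
  | and α β ih₁ ih₂ =>
    obtain ⟨h₁, h₂⟩ := ih₁ (Set.subset_union_left.trans hs)
    obtain ⟨h₃, h₄⟩ := ih₂ (Set.subset_union_right.trans hs)
    refine ⟨fun h => .andI (h₁ h.1) (h₃ h.2), fun h => .negI' hc ?_⟩
    have hd : Derives (insert (CForm.and α β).toForm (literals f s))
      (.and α.toForm β.toForm) := .head
    by_cases ha : α.Holds f
    · exact .negE (.andE₂ hd) (h₄ fun hb => h ⟨ha, hb⟩).weaken
    · exact .negE (.andE₁ hd) (h₂ ha).weaken
  | or α β ih₁ ih₂ =>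
    obtain ⟨h₁, h₂⟩ := ih₁ (Set.subset_union_left.trans hs)
    obtain ⟨h₃, h₄⟩ := ih₂ (Set.subset_union_right.trans hs)
    refine ⟨fun h => h.elim (fun h => .orI₁ (h₁ h)) fun h => .orI₂ (h₃ h), fun h => .negI' hc ?_⟩
    rw [CForm.Holds, not_or] at h
    exact .orE' (forall_insert_classical (CForm.isClassical _) hc)
      (.head : Derives _ (.or α.toForm β.toForm))
      (.negE .head (h₂ h.1).weaken.weaken) (.negE .head (h₄ h.2).weaken.weaken)

theorem Derives.em (Γ : Set (Form V)) (α : CForm V) : Derives Γ (.or α.toForm (.neg α)) := by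
  have hc : ∀ δ ∈ ({Form.neg (.or α (.neg α))} : Set (Form V)), δ.IsClassical := by
    rintro _ rfl
    exact Form.isClassical_neg _
  refine .raa (α := .or α (.neg α)) (Set.empty_subset _) (fun _ h => h.elim) ?_
  rw [insert_empty_eq]
  refine .negE (α := .or α (.neg α)) (.orI₂ (.negI' hc ?_)) (.self _)
  exact .negE (α := .or α (.neg α)) (.orI₁ .head) (Derives.self _).weaken

/-- Variables are removed one at a time: excluded middle for `p` merges the derivations from `p` and
from `¬p`. The set `Γ` is classical because it is carried through the side condition of `orE`. -/
theorem derives_of_literals {Γ : Set (Form V)} (hΓ : ∀ δ ∈ Γ, δ.IsClassical) {χ : Form V}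
    {s : Set V} (hs : s.Finite) (h : ∀ f, Derives (literals f s ∪ Γ) χ) : Derives Γ χ := by
  classical
  induction s, hs using Set.Finite.induction_on with
  | empty => simpa [literals] using h fun _ => true
  | @insert p s hp _ ih =>
    refine ih fun f => ?_
    have hl : ∀ b, literals (Function.update f p b) (insert p s) ∪ Γ =
        insert ((Arg.var p).pow b).toForm (literals f s ∪ Γ) := by
      intro b
      rw [literals, Set.image_insert_eq, Set.insert_union, Function.update_self]
      congr 2
      refine Set.image_congr fun q hq => ?_
      rw [Function.update_of_ne (by rintro rfl; exact hp hq)]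
    have hc : ∀ δ ∈ literals f s ∪ Γ, δ.IsClassical := by
      rintro δ (hδ | hδ)
      exacts [literals_classical f s δ hδ, hΓ δ hδ]
    refine .orE' hc (.em _ (.var p)) ?_ ?_
    · exact hl true ▸ h (Function.update f p true)
    · exact hl false ▸ h (Function.update f p false)

/-- With one classical premise all side conditions are met; `Derives.classical` then reaches
arbitrary contexts by cut. -/
theorem derives_singleton_of_holds {α β : CForm V} (h : ∀ f, β.Holds f → α.Holds f) :
    Derives {β.toForm} α.toForm := by
  have hc : ∀ δ ∈ ({β.toForm} : Set (Form V)), δ.IsClassical := by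
    rintro _ rfl
    exact CForm.isClassical _
  refine derives_of_literals hc (α.finite_vars.union β.finite_vars) fun f => ?_
  by_cases hβ : β.Holds f
  · exact ((derives_literals Set.subset_union_left).1 (h f hβ)).mono Set.subset_union_left
  · exact .negE (α := β) (.assumption (.inr rfl))
      (((derives_literals Set.subset_union_right).2 hβ).mono Set.subset_union_left)

theorem Derives.classical {Γ : Set (Form V)} {α β : CForm V} (hβ : Derives Γ β.toForm)
    (h : ∀ f, β.Holds f → α.Holds f) : Derives Γ α.toForm :=
  hβ.trans (derives_singleton_of_holds h)

theorem Derives.taut {Γ : Set (Form V)} {α : CForm V} (h : ∀ f, α.Holds f) :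
    Derives Γ α.toForm :=
  .classical (β := .top) .topI fun f _ => h f

/-! ### Inclusion atoms -/

theorem CForm.holds_conj {f : V → Bool} {L : List (CForm V)} :
    (CForm.conj L).Holds f ↔ ∀ α ∈ L, α.Holds f := by
  induction L with
  | nil => simp [conj, Holds]
  | cons α L ih =>
    cases L with
    | nil => simp [conj]
    | cons β L => rw [conj, Holds, ih, List.forall_mem_cons (a := α)]

theorem Arg.holds_pow {f : V → Bool} {a : Arg V} {x : Bool} :
    (a.pow x).Holds f ↔ a.eval f = x := by
  cases a <;> cases x <;> simp [pow, CForm.Holds, eval]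

theorem holds_seqPow {f : V → Bool} {k : ℕ} {a : Fin k → Arg V} {x : Fin k → Bool} :
    (seqPow a x).Holds f ↔ ∀ i, (a i).eval f = x i := by
  simp [seqPow, CForm.holds_conj, Arg.holds_pow]

theorem Arg.holds_toCForm {f : V → Bool} {a : Arg V} : a.toCForm.Holds f ↔ a.eval f = true := by
  cases a <;> simp [toCForm, CForm.Holds, eval]

theorem CForm.holds_subst {W : Type*} {f : V → Bool} {s : W → Arg V} {α : CForm W} :
    (α.subst s).Holds f ↔ α.Holds fun i => (s i).eval f := by
  induction α with
  | var i => exact Arg.holds_toCForm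
  | bot => rfl
  | top => rfl
  | neg α ih => exact not_congr ih
  | and α β ih₁ ih₂ => exact and_congr ih₁ ih₂
  | or α β ih₁ ih₂ => exact or_congr ih₁ ih₂

theorem Arg.eval_const (f : V → Bool) (x : Bool) : (Arg.const x).eval f = x := by
  cases x <;> rfl

theorem CForm.constFree_conj {L : List (CForm V)} (h : ∀ α ∈ L, α.ConstFree) (hL : L ≠ []) :
    (CForm.conj L).ConstFree := by
  induction L with
  | nil => exact (hL rfl).elim
  | cons α L ih =>
    rw [List.forall_mem_cons] at h
    cases L with
    | nil => exact h.1
    | cons β L => exact ⟨h.1, ih h.2 (by simp)⟩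

/-- `x ⊆ a` and `¬ a ^ x` are inconsistent. -/
theorem Derives.bot_of_primIncl {Γ : Set (Form V)} {k : ℕ} {x : Fin k → Bool}
    {a : Fin k → Arg V} (h : Derives Γ (.primIncl x a))
    (h' : Derives Γ (.neg (seqPow a x))) : Derives Γ .bot := by
  -- Filled with `a`, the template is classically equivalent to `¬ a ^ x`; filled with the constants
  -- `x`, it is false. Hence `inclCmp` produces a contradiction.
  let τ : CForm (Fin k) := .neg (seqPow (fun i => .var i) x)
  have hτ : ∀ (f : V → Bool) (s : Fin k → Arg V),
      (τ.subst s).Holds f ↔ ¬ ∀ i, (s i).eval f = x i := fun f s => by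
    rw [CForm.holds_subst, CForm.Holds, holds_seqPow]
    rfl
  -- For `k = 0` the template would contain the empty conjunction `⊤`, a forbidden constant. In that
  -- case `¬ a ^ x` is already contradictory.
  rcases Nat.eq_zero_or_pos k with rfl | hk
  · exact .classical (β := .neg (seqPow a x)) (α := .bot) h' fun f hf =>
      hf (holds_seqPow.2 fun i => i.elim0)
  · have hfree : τ.ConstFree := by
      refine CForm.constFree_conj ?_ ?_
      · rw [List.forall_mem_ofFn_iff]
        intro i
        cases x i <;> trivial
      · simpa [List.ofFn_eq_nil_iff] using hk.ne'
    have h₁ : Derives Γ (τ.subst a).toForm :=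
      .classical (β := .neg (seqPow a x)) h' fun f hf => by
        rw [hτ]
        exact fun hi => hf (holds_seqPow.2 hi)
    refine .classical (α := .bot) (.inclCmp hfree h h₁) fun f hf => ?_
    rw [hτ] at hf
    exact hf fun i => Arg.eval_const f (x i)

/-- The atom grows column by column from the empty one. The four extension rules treat matching
constants and decided variables; a mismatched constant has power `⊥`. -/
theorem Derives.primIncl_of_pow {Γ : Set (Form V)} {k : ℕ} {x : Fin k → Bool}
    {a : Fin k → Arg V} (h : ∀ i, Derives Γ ((a i).pow (x i)).toForm) :
    Derives Γ (.primIncl x a) := by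
  induction k with
  | zero =>
    rw [Subsingleton.elim a fun i => Arg.const (x i)]
    exact .inclId
  | succ k ih =>
    have ht : Derives Γ (.incl (fun i => Arg.const (x (Fin.succ i))) (Fin.tail a)) :=
      ih (x := Fin.tail x) (a := Fin.tail a) fun i => h i.succ
    have h0 := h 0
    have e : Form.primIncl x a = .incl (k := k + 1)
        (Fin.cons (Arg.const (x 0)) fun i => Arg.const (x (Fin.succ i)))
        (Fin.cons (a 0) (Fin.tail a)) := by
      rw [Fin.cons_self_tail, Form.primIncl]
      congr 1
      exact (Fin.cons_self_tail (α := fun _ => Arg V) fun i => Arg.const (x i)).symm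
    rw [e]
    cases ha : a 0 <;> cases hx : x 0 <;> rw [ha, hx] at h0
    · exact .inclExtNegVar h0 ht
    · exact .inclExtVar h0 ht
    · exact exFalso h0
    · exact .inclExtTop ht
    · exact .inclExtBot ht
    · exact exFalso h0

/-- The inclusion atom whose columns are given by a list of pairs. -/
def Form.inclList (L : List (Arg V × Arg V)) : Form V :=
  .incl (fun i : Fin L.length => (L.get i).1) fun i => (L.get i).2

/-- The length of a concatenated list equals the sum appearing in the rules only propositionally, so
atoms are compared along a cast of indices. -/
theorem Form.incl_congr {k k' : ℕ} (h : k = k') {a b : Fin k → Arg V} {a' b' : Fin k' → Arg V}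
    (ha : ∀ i, a i = a' (Fin.cast h i)) (hb : ∀ i, b i = b' (Fin.cast h i)) :
    Form.incl a b = Form.incl a' b' := by
  subst h
  rw [funext ha, funext hb]
  rfl

theorem Form.inclList_ofFn {k : ℕ} (a b : Fin k → Arg V) :
    Form.inclList (List.ofFn fun i => (a i, b i)) = .incl a b :=
  incl_congr (by simp) (fun i => by simp; rfl) fun i => by simp; rfl

theorem append_get {α β : Type*} (A B : List α) (g : α → β) (i : Fin (A.length + B.length)) :
    Fin.append (fun i => g (A.get i)) (fun i => g (B.get i)) i =
      g ((A ++ B).get (Fin.cast List.length_append.symm i)) := by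
  induction i using Fin.addCases with
  | left i => simp
  | right i => simp

theorem Form.inclList_append (A B : List (Arg V × Arg V)) :
    Form.inclList (A ++ B) = .incl
      (Fin.append (fun i => (A.get i).1) fun i => (B.get i).1)
      (Fin.append (fun i => (A.get i).2) fun i => (B.get i).2) := by
  refine (incl_congr List.length_append.symm (fun i => ?_) fun i => ?_).symm
  · exact append_get A B Prod.fst i
  · exact append_get A B Prod.snd i

theorem append_append_get {α β : Type*} (A B C : List α) (g : α → β)
    (i : Fin (A.length + B.length + C.length)) :
    Fin.append (Fin.append (fun i => g (A.get i)) fun i => g (B.get i)) (fun i => g (C.get i)) i =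
      g ((A ++ B ++ C).get (Fin.cast (by simp [Nat.add_assoc]) i)) := by
  induction i using Fin.addCases with
  | left i =>
    rw [Fin.append_left, append_get]
    simp only [List.get_eq_getElem, Fin.val_cast, Fin.val_castAdd]
    rw [List.getElem_append_left (as := A ++ B)]
  | right i =>
    rw [Fin.append_right]
    simp only [List.get_eq_getElem, Fin.val_cast, Fin.val_natAdd]
    rw [List.getElem_append_right (as := A ++ B) (by simp)]
    simp

theorem Form.inclList_append_append (A B C : List (Arg V × Arg V)) :
    Form.inclList (A ++ B ++ C) = .incl
      (Fin.append (Fin.append (fun i => (A.get i).1) fun i => (B.get i).1) fun i => (C.get i).1)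
      (Fin.append (Fin.append (fun i => (A.get i).2) fun i => (B.get i).2)
        fun i => (C.get i).2) := by
  refine (incl_congr (by simp [Nat.add_assoc]) (fun i => ?_) fun i => ?_).symm
  · exact append_append_get A B C Prod.fst i
  · exact append_append_get A B C Prod.snd i

theorem Derives.inclList_exc {Γ : Set (Form V)} {A B C : List (Arg V × Arg V)}
    (h : Derives Γ (.inclList (A ++ B ++ C))) : Derives Γ (.inclList (B ++ A ++ C)) := by
  rw [Form.inclList_append_append] at h ⊢
  exact .inclExc h

theorem Derives.inclList_ctr {Γ : Set (Form V)} {A B : List (Arg V × Arg V)}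
    (h : Derives Γ (.inclList (A ++ B))) : Derives Γ (.inclList A) := by
  rw [Form.inclList_append] at h
  exact .inclCtr h

theorem Derives.inclList_wk {Γ : Set (Form V)} {A B : List (Arg V × Arg V)}
    (h : Derives Γ (.inclList (A ++ B))) : Derives Γ (.inclList (A ++ A ++ B)) := by
  rw [Form.inclList_append] at h
  rw [Form.inclList_append_append]
  exact .inclWk h

theorem Derives.inclList_cons_of_mem {Γ : Set (Form V)} {L : List (Arg V × Arg V)}
    {P : Arg V × Arg V} (hP : P ∈ L) (h : Derives Γ (.inclList L)) :
    Derives Γ (.inclList (P :: L)) := by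
  obtain ⟨s, t, rfl⟩ := List.append_of_mem hP
  -- Exchange brings `P` to the front, weakening doubles it, and a second exchange returns one copy
  -- to its old place.
  have h₁ : Derives Γ (.inclList (s ++ [P] ++ t)) := by simpa using h
  have h₂ : Derives Γ (.inclList ([P] ++ (s ++ t))) := by simpa using h₁.inclList_exc
  have h₃ : Derives Γ (.inclList ([P] ++ ([P] ++ s) ++ t)) := by simpa using h₂.inclList_wk
  simpa using h₃.inclList_exc

theorem Derives.inclList_cons_const {Γ : Set (Form V)} {L : List (Arg V × Arg V)} (x : Bool)
    (h : Derives Γ (.inclList L)) :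
    Derives Γ (.inclList ((Arg.const x, Arg.const x) :: L)) := by
  have e : ∀ c : Arg V, Form.inclList ((c, c) :: L) = .incl (k := L.length + 1)
      (Fin.cons c fun i => (L.get i).1) (Fin.cons c fun i => (L.get i).2) := fun c =>
    Form.incl_congr rfl (fun i => by cases i using Fin.cases <;> rfl)
      fun i => by cases i using Fin.cases <;> rfl
  rw [e]
  cases x
  exacts [.inclExtBot h, .inclExtTop h]

/-- Columns of an inclusion atom may be selected, repeated and permuted, and trivial constant
columns may be added. -/
theorem Derives.inclList_of_subset {Γ : Set (Form V)} {L M : List (Arg V × Arg V)}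
    (h : Derives Γ (.inclList L))
    (hM : ∀ P ∈ M, P ∈ L ∨ ∃ x, P = (Arg.const x, Arg.const x)) : Derives Γ (.inclList M) := by
  -- Columns of `M` are collected in front of `L`, so that all of `L` remains available until
  -- contraction discards it.
  suffices Derives Γ (.inclList (M ++ L)) from this.inclList_ctr
  induction M with
  | nil => exact h
  | cons P M ih =>
    rw [List.forall_mem_cons] at hM
    rcases hM.1 with hP | ⟨x, rfl⟩
    · exact (ih hM.2).inclList_cons_of_mem (List.mem_append_right _ hP)
    · exact (ih hM.2).inclList_cons_const x

/-! ### Team semantics and soundness -/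

section Semantics

variable {N : Set V}

/-- The extension of a valuation to all variables, with value `false` outside its domain. -/
noncomputable def Valuation.ext (v : Valuation N) : V → Bool := fun p => (Arg.var p).val v

theorem Arg.val_eq_eval (v : Valuation N) (a : Arg V) : a.val v = a.eval v.ext := by
  cases a <;> rfl

theorem Arg.val_const (v : Valuation N) (x : Bool) : (Arg.const x).val v = x := by
  rw [val_eq_eval, eval_const]

theorem Valuation.ext_coe (v : Valuation N) (p : N) : v.ext p = v p := by
  simp [ext, Arg.val]

/-- Classical formulas are flat. -/
theorem CForm.sat_iff {X : Team N} {α : CForm V} : α.Sat X ↔ ∀ v ∈ X, α.Holds v.ext := by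
  induction α generalizing X with
  | var p => rfl
  | bot => exact Set.eq_empty_iff_forall_notMem
  | top => simp [Sat, Holds]
  | neg α ih => simp [Sat, Holds, ih]
  | and α β ih₁ ih₂ =>
    simp only [Sat, Holds, ih₁, ih₂]
    exact ⟨fun h v hv => ⟨h.1 v hv, h.2 v hv⟩, fun h => ⟨fun v hv => (h v hv).1,
      fun v hv => (h v hv).2⟩⟩
  | or α β ih₁ ih₂ =>
    simp only [Sat, Holds, ih₁, ih₂]
    constructor
    · rintro ⟨Y, Z, -, -, rfl, hY, hZ⟩ v (hv | hv)
      exacts [.inl (hY v hv), .inr (hZ v hv)]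
    · intro h
      refine ⟨{v ∈ X | α.Holds v.ext}, {v ∈ X | β.Holds v.ext}, fun _ h => h.1, fun _ h => h.1,
        ?_, fun _ h => h.2, fun _ h => h.2⟩
      ext v
      exact ⟨fun hv => (h v hv).imp (fun h => ⟨hv, h⟩) fun h => ⟨hv, h⟩,
        fun hv => hv.elim (fun h => h.1) fun h => h.1⟩

theorem CForm.sat_toForm {X : Team N} {α : CForm V} : α.toForm.Sat X ↔ α.Sat X := by
  induction α generalizing X with
  | var p => rfl
  | bot => rfl
  | top => rfl
  | neg α ih => rfl
  | and α β ih₁ ih₂ => exact and_congr ih₁ ih₂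
  | or α β ih₁ ih₂ => simp only [toForm, Sat, Form.Sat, ih₁, ih₂]

theorem CForm.toForm_sat_iff {X : Team N} {α : CForm V} :
    α.toForm.Sat X ↔ ∀ v ∈ X, α.Holds v.ext :=
  sat_toForm.trans sat_iff

theorem Form.neg_sat_iff {X : Team N} {α : CForm V} :
    (Form.neg α).Sat X ↔ ∀ v ∈ X, ¬ α.Holds v.ext :=
  CForm.toForm_sat_iff (α := .neg α)

theorem Form.IsClassical.sat_subset {X Y : Team N} {φ : Form V} (hφ : φ.IsClassical)
    (h : φ.Sat X) (hY : Y ⊆ X) : φ.Sat Y := by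
  obtain ⟨α, rfl⟩ := hφ
  rw [CForm.toForm_sat_iff] at h ⊢
  exact fun v hv => h v (hY hv)

theorem Form.sat_empty (φ : Form V) : φ.Sat (∅ : Team N) := by
  induction φ with
  | var p => exact fun _ h => h.elim
  | bot => rfl
  | top => trivial
  | neg α => exact fun _ h => h.elim
  | and φ ψ ih₁ ih₂ => exact ⟨ih₁, ih₂⟩
  | or φ ψ ih₁ ih₂ => exact ⟨∅, ∅, subset_rfl, subset_rfl, by simp, ih₁, ih₂⟩
  | incl a b => exact fun _ h => h.elim

/-- Formulas are closed under unions of teams. -/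
theorem Form.Sat.union {φ : Form V} {X Y : Team N} (hX : φ.Sat X) (hY : φ.Sat Y) :
    φ.Sat (X ∪ Y) := by
  induction φ generalizing X Y with
  | var p =>
    rintro v (hv | hv)
    exacts [hX v hv, hY v hv]
  | bot => exact Set.union_empty_iff.2 ⟨hX, hY⟩
  | top => trivial
  | neg α =>
    rintro v (hv | hv)
    exacts [hX v hv, hY v hv]
  | and φ ψ ih₁ ih₂ => exact ⟨ih₁ hX.1 hY.1, ih₂ hX.2 hY.2⟩
  | or φ ψ ih₁ ih₂ =>
    obtain ⟨A, B, -, -, rfl, hA, hB⟩ := hX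
    obtain ⟨C, D, -, -, rfl, hC, hD⟩ := hY
    have e : A ∪ B ∪ (C ∪ D) = A ∪ C ∪ (B ∪ D) := Set.union_union_union_comm ..
    exact ⟨A ∪ C, B ∪ D, e ▸ Set.subset_union_left, e ▸ Set.subset_union_right, e, ih₁ hA hC,
      ih₂ hB hD⟩
  | incl a b =>
    rintro v (hv | hv)
    · obtain ⟨u, hu, h⟩ := hX v hv
      exact ⟨u, .inl hu, h⟩
    · obtain ⟨u, hu, h⟩ := hY v hv
      exact ⟨u, .inr hu, h⟩

theorem Form.sat_or {X Y Z : Team N} {φ ψ : Form V} (h : X = Y ∪ Z) (hY : φ.Sat Y)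
    (hZ : ψ.Sat Z) : (Form.or φ ψ).Sat X :=
  ⟨Y, Z, h ▸ Set.subset_union_left, h ▸ Set.subset_union_right, h, hY, hZ⟩

theorem Form.primIncl_sat_iff {X : Team N} {k : ℕ} {x : Fin k → Bool} {a : Fin k → Arg V} :
    (Form.primIncl x a).Sat X ↔ (X.Nonempty → ∃ u ∈ X, ∀ i, (a i).val u = x i) := by
  simp only [primIncl, Sat, Arg.val_const, eq_comm (a := x _)]
  exact ⟨fun h ⟨v, hv⟩ => h v hv, fun h v hv => h ⟨v, hv⟩⟩

theorem Form.conj_sat_iff {X : Team N} {L : List (Form V)} :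
    (Form.conj L).Sat X ↔ ∀ φ ∈ L, φ.Sat X := by
  induction L with
  | nil => simp [conj, Sat]
  | cons α L ih =>
    cases L with
    | nil => simp [conj]
    | cons β L => rw [conj, Sat, ih, List.forall_mem_cons (a := α)]

theorem sat_foldl_and {X : Team N} {L : List (PrimAtom V)} {φ : Form V} (h : φ.Sat X)
    (hL : ∀ P ∈ L, P.toForm.Sat X) : (L.foldl (fun χ P => .and χ P.toForm) φ).Sat X := by
  induction L generalizing φ with
  | nil => exact h
  | cons P L ih =>
    rw [List.forall_mem_cons] at hL
    exact ih (φ := .and φ P.toForm) ⟨h, hL.1⟩ hL.2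

theorem sat_foldl_or {Y W : Team N} {L : List (PrimAtom V)} {φ : Form V} (h : φ.Sat Y)
    (hW : ∀ v ∈ W, ∃ P ∈ L, P.power.Holds v.ext) :
    (L.foldl (fun χ P => .or χ P.power.toForm) φ).Sat (Y ∪ W) := by
  induction L generalizing φ Y W with
  | nil =>
    have : W = ∅ := Set.eq_empty_iff_forall_notMem.2 fun v hv => by simpa using hW v hv
    simpa [this] using h
  | cons P L ih =>
    -- Members of `W` satisfying the first power join the disjunction formed so far; the others are
    -- left to the remaining powers.
    have e : Y ∪ W = (Y ∪ {v ∈ W | P.power.Holds v.ext}) ∪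
        {v ∈ W | ¬ P.power.Holds v.ext} := by
      ext v
      simp only [Set.mem_union, Set.mem_ofPred_eq]
      tauto
    rw [e]
    refine ih (Form.sat_or rfl h (CForm.toForm_sat_iff.2 fun v hv => hv.2)) fun v hv => ?_
    obtain ⟨Q, hQ, h⟩ := hW v hv.1
    rcases List.mem_cons.1 hQ with rfl | hQ
    exacts [(hv.2 h).elim, ⟨Q, hQ, h⟩]

/-- The left half is enlarged by all members of the team that satisfy one of the powers. The
witnesses of the inclusion atoms are among them, and lax semantics permits the halves to overlap. -/
theorem sat_dst {X : Team N} {φ ψ : Form V} {L : List (PrimAtom V)} (h : (Form.or φ ψ).Sat X)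
    (hL : ∀ P ∈ L, P.toForm.Sat X) : (Form.dst φ ψ L).Sat X := by
  obtain ⟨Y, Z, hY, hZ, rfl, h₁, h₂⟩ := h
  let W : Team N := {v ∈ Y ∪ Z | ∃ P ∈ L, P.power.Holds v.ext}
  have hW : W ⊆ Y ∪ Z := fun _ h => h.1
  refine Form.sat_or (Y := Y ∪ W) (Z := Z) ?_ (sat_foldl_and ?_ ?_) h₂
  · rw [Set.union_right_comm, Set.union_eq_left.2 hW]
  · exact sat_foldl_or h₁ fun v hv => hv.2
  · intro P hP
    refine Form.primIncl_sat_iff.2 fun ⟨v, hv⟩ => ?_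
    obtain ⟨u, hu, h⟩ := Form.primIncl_sat_iff.1 (hL P hP)
      ⟨v, Set.union_subset hY hW hv⟩
    refine ⟨u, .inr ⟨hu, P, hP, holds_seqPow.2 fun i => ?_⟩, h⟩
    rw [← Arg.val_eq_eval, h]

theorem forall_append {α β : Type*} {m n : ℕ} {a : Fin m → α} {a' : Fin n → α}
    {c : Fin m → β} {c' : Fin n → β} {R : α → β → Prop} :
    (∀ i, R (Fin.append a a' i) (Fin.append c c' i)) ↔
      (∀ i, R (a i) (c i)) ∧ ∀ i, R (a' i) (c' i) := by
  constructor
  · intro h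
    exact ⟨fun i => by simpa using h (Fin.castAdd n i), fun i => by simpa using h (Fin.natAdd m i)⟩
  · rintro ⟨h₁, h₂⟩ i
    induction i using Fin.addCases with
    | left i => simpa using h₁ i
    | right i => simpa using h₂ i

theorem sat_incl_append {X : Team N} {m n : ℕ} {a c : Fin m → Arg V} {b d : Fin n → Arg V} :
    (Form.incl (Fin.append a b) (Fin.append c d)).Sat X ↔ ∀ v ∈ X, ∃ u ∈ X,
      (∀ i, (a i).val v = (c i).val u) ∧ ∀ i, (b i).val v = (d i).val u := by
  have (u v : Valuation N) := forall_append (a := a) (a' := b) (c := c) (c' := d)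
    (R := fun p q => p.val v = q.val u)
  simp only [Form.Sat, this]

theorem sat_incl_append_append {X : Team N} {l m n : ℕ} {a a' : Fin l → Arg V}
    {b b' : Fin m → Arg V} {c c' : Fin n → Arg V} :
    (Form.incl (Fin.append (Fin.append a b) c) (Fin.append (Fin.append a' b') c')).Sat X ↔
      ∀ v ∈ X, ∃ u ∈ X, ((∀ i, (a i).val v = (a' i).val u) ∧
        ∀ i, (b i).val v = (b' i).val u) ∧ ∀ i, (c i).val v = (c' i).val u := by
  have (u v : Valuation N) := forall_append (a := a) (a' := b) (c := a') (c' := b')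
    (R := fun p q => p.val v = q.val u)
  simp only [sat_incl_append, this]

theorem sat_incl_cons {X : Team N} {k : ℕ} {a b : Fin k → Arg V} {c d : Arg V}
    (h : (Form.incl a b).Sat X) (hcd : ∀ v ∈ X, ∀ u ∈ X, c.val v = d.val u) :
    (Form.incl (k := k + 1) (Fin.cons c a) (Fin.cons d b)).Sat X := by
  intro v hv
  obtain ⟨u, hu, h⟩ := h v hv
  refine ⟨u, hu, fun i => ?_⟩
  cases i using Fin.cases with
  | zero => exact hcd v hv u hu
  | succ i => exact h i

/-- Reduction of inclusion atoms to primitive ones, semantically. -/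
theorem sat_imp_primIncl_iff {X : Team N} {k : ℕ} {a b : Fin k → Arg V} {x : Fin k → Bool} :
    (Form.imp (seqPow a x) (Form.primIncl x b)).Sat X ↔
      ((∃ v ∈ X, ∀ i, (a i).val v = x i) → ∃ u ∈ X, ∀ i, (b i).val u = x i) := by
  have hp : ∀ v : Valuation N, (seqPow a x).Holds v.ext ↔ ∀ i, (a i).val v = x i := fun v => by
    simp only [holds_seqPow, Arg.val_eq_eval]
  constructor
  · rintro ⟨Y, Z, hY, hZ, rfl, h₁, h₂⟩ ⟨v, hv | hv, h⟩
    · exact (Form.neg_sat_iff.1 h₁ v hv ((hp v).2 h)).elim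
    · obtain ⟨u, hu, h⟩ := Form.primIncl_sat_iff.1 h₂ ⟨v, hv⟩
      exact ⟨u, hZ hu, h⟩
  · intro h
    by_cases hx : ∃ v ∈ X, ∀ i, (a i).val v = x i
    · exact Form.sat_or (Set.empty_union X).symm (Form.sat_empty _)
        (Form.primIncl_sat_iff.2 fun _ => h hx)
    · exact Form.sat_or (Set.union_empty X).symm
        (Form.neg_sat_iff.2 fun v hv hv' => hx ⟨v, hv, (hp v).1 hv'⟩) (Form.sat_empty _)

theorem sat_reduct_iff {X : Team N} {k : ℕ} {a b : Fin k → Arg V} :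
    (Form.reduct a b).Sat X ↔ (Form.incl a b).Sat X := by
  simp only [Form.reduct, Form.conj_sat_iff, List.forall_mem_map, sat_imp_primIncl_iff]
  constructor
  · intro h v hv
    obtain ⟨u, hu, h⟩ := h (fun i => (a i).val v) (mem_allConsts _) ⟨v, hv, fun _ => rfl⟩
    exact ⟨u, hu, fun i => (h i).symm⟩
  · rintro h x - ⟨v, hv, hx⟩
    obtain ⟨u, hu, h⟩ := h v hv
    exact ⟨u, hu, fun i => by rw [← h, hx]⟩

end Semantics

/-- Soundness, for teams with an arbitrary domain. -/
theorem Derives.sound {Γ : Set (Form V)} {φ : Form V} (h : Derives Γ φ) {N : Set V}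
    {X : Team N} (hX : ∀ γ ∈ Γ, γ.Sat X) : φ.Sat X := by
  have hins : ∀ {Γ : Set (Form V)} {φ : Form V} {X : Team N}, φ.Sat X → (∀ γ ∈ Γ, γ.Sat X) →
      ∀ γ ∈ insert φ Γ, γ.Sat X := by
    rintro Γ φ X h₁ h₂ γ (rfl | hγ)
    exacts [h₁, h₂ γ hγ]
  induction h generalizing X with
  | assumption h => exact hX _ h
  | topI => trivial
  | @negI Γ Δ α h₁ h₂ _ ih =>
    -- The subderivation is evaluated on the singleton `{v}`, which inherits the classical
    -- assumptions `Δ` by flatness.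
    refine Form.neg_sat_iff.2 fun v hv hα => ?_
    refine Set.singleton_ne_empty v (ih (X := {v}) (hins ?_ fun δ hδ => ?_))
    · exact CForm.toForm_sat_iff.2 fun u hu => hu ▸ hα
    · exact (h₂ δ hδ).sat_subset (hX δ (h₁ hδ)) (Set.singleton_subset_iff.2 hv)
  | @negE Γ α φ _ _ ih₁ ih₂ =>
    have : X = ∅ := Set.eq_empty_iff_forall_notMem.2 fun v hv =>
      Form.neg_sat_iff.1 (ih₂ hX) v hv (CForm.toForm_sat_iff.1 (ih₁ hX) v hv)
    exact this ▸ Form.sat_empty _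
  | @raa Γ Δ α h₁ h₂ _ ih =>
    refine CForm.toForm_sat_iff.2 fun v hv => by_contra fun hα => ?_
    refine Set.singleton_ne_empty v (ih (X := {v}) (hins ?_ fun δ hδ => ?_))
    · exact Form.neg_sat_iff.2 fun u hu => hu ▸ hα
    · exact (h₂ δ hδ).sat_subset (hX δ (h₁ hδ)) (Set.singleton_subset_iff.2 hv)
  | andI _ _ ih₁ ih₂ => exact ⟨ih₁ hX, ih₂ hX⟩
  | andE₁ _ ih => exact (ih hX).1
  | andE₂ _ ih => exact (ih hX).2
  | orI₁ _ ih => exact Form.sat_or (Set.union_empty X).symm (ih hX) (Form.sat_empty _)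
  | orI₂ _ ih => exact Form.sat_or (Set.empty_union X).symm (Form.sat_empty _) (ih hX)
  | orE h₁ h₂ h₃ h₄ _ _ _ ih ih₁ ih₂ =>
    obtain ⟨Y, Z, hY, hZ, rfl, hφ, hψ⟩ := ih hX
    -- Classical side assumptions pass to both halves, and union closure brings `χ` back to the
    -- whole team.
    exact (ih₁ (hins hφ fun δ hδ => (h₂ δ hδ).sat_subset (hX δ (h₁ hδ)) hY)).union
      (ih₂ (hins hψ fun δ hδ => (h₄ δ hδ).sat_subset (hX δ (h₃ hδ)) hZ))
  | inclExc _ ih =>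
    refine sat_incl_append_append.2 fun v hv => ?_
    obtain ⟨u, hu, h, h'⟩ := sat_incl_append_append.1 (ih hX) v hv
    exact ⟨u, hu, h.symm, h'⟩
  | inclCtr _ ih =>
    intro v hv
    obtain ⟨u, hu, h, -⟩ := sat_incl_append.1 (ih hX) v hv
    exact ⟨u, hu, h⟩
  | inclWk _ ih =>
    refine sat_incl_append_append.2 fun v hv => ?_
    obtain ⟨u, hu, h, h'⟩ := sat_incl_append.1 (ih hX) v hv
    exact ⟨u, hu, ⟨h, h⟩, h'⟩
  | inclTrs _ _ ih₁ ih₂ =>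
    intro v hv
    obtain ⟨u, hu, h⟩ := ih₁ hX v hv
    obtain ⟨w, hw, h'⟩ := ih₂ hX u hu
    exact ⟨w, hw, fun i => (h i).trans (h' i)⟩
  | inclId => exact fun v hv => ⟨v, hv, fun _ => rfl⟩
  | inclCmp _ _ _ ih₁ ih₂ =>
    refine CForm.toForm_sat_iff.2 fun v hv => ?_
    obtain ⟨u, hu, h⟩ := ih₁ hX v hv
    have := CForm.toForm_sat_iff.1 (ih₂ hX) u hu
    simp only [CForm.holds_subst, ← Arg.val_eq_eval] at this ⊢
    simpa only [h] using this
  | inclExtTop _ ih => exact sat_incl_cons (ih hX) fun _ _ _ _ => rfl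
  | inclExtVar _ _ ih₁ ih₂ => exact sat_incl_cons (ih₂ hX) fun _ _ u hu => (ih₁ hX u hu).symm
  | inclExtBot _ ih => exact sat_incl_cons (ih hX) fun _ _ _ _ => rfl
  | inclExtNegVar _ _ ih₁ ih₂ =>
    refine sat_incl_cons (ih₂ hX) fun _ _ u hu => ?_
    exact (Bool.eq_false_iff.2 (Form.neg_sat_iff.1 (ih₁ hX) u hu)).symm
  | @orInclE Γ k x a φ ψ χ _ _ _ _ ih₁ _ ih₃ ih₄ =>
    obtain ⟨Y, Z, hY, hZ, rfl, hφ, hψ⟩ := ih₁ hX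
    -- If `Y` is empty, the team is `Z` and satisfies `ψ`. Otherwise the witness of `x ⊆ a` in `Y`
    -- makes the atom true in the whole team.
    rcases Y.eq_empty_or_nonempty with rfl | hne
    · refine ih₃ (hins ?_ hX)
      rwa [Set.empty_union]
    · refine ih₄ (hins (Form.sat_or rfl hφ.1 hψ) (hins (Form.primIncl_sat_iff.2 fun _ => ?_) hX))
      obtain ⟨u, hu, h⟩ := Form.primIncl_sat_iff.1 hφ.2 hne
      exact ⟨u, hY hu, h⟩
  | inclDst _ _ ih₁ ih₂ => exact sat_dst (ih₁ hX) fun P hP => ih₂ P hP hX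
  | inclExt _ ih => exact sat_reduct_iff.1 (ih hX)
  | inclRdt x _ ih =>
    have := sat_reduct_iff.2 (ih hX)
    simp only [Form.reduct, Form.conj_sat_iff, List.forall_mem_map] at this
    exact this x (mem_allConsts x)

theorem Derives.entails {Γ : Set (Form V)} {φ : Form V} (h : Derives Γ φ) : Entails Γ φ :=
  fun _ _ _ hX => h.sound hX

/-! ### Normal forms over a finite domain -/

/-- Finite disjunctions of classical formulas; the empty one is `⊥`. -/
def CForm.disj (L : List (CForm V)) : CForm V := L.foldr .or .bot

theorem CForm.toForm_disj (L : List (CForm V)) :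
    (CForm.disj L).toForm = Form.disj (L.map CForm.toForm) := by
  induction L with
  | nil => rfl
  | cons α L ih =>
    change Form.or α.toForm (CForm.disj L).toForm = _
    rw [ih]
    rfl

theorem CForm.holds_disj {f : V → Bool} {L : List (CForm V)} :
    (CForm.disj L).Holds f ↔ ∃ α ∈ L, α.Holds f := by
  induction L with
  | nil => simp [disj, Holds]
  | cons α L ih =>
    change α.Holds f ∨ (CForm.disj L).Holds f ↔ _
    rw [ih]
    simp

/-- The conjunction of `φ` with the formulas of a list. -/
def Form.andAll (φ : Form V) (L : List (Form V)) : Form V := L.foldr (fun P χ => .and χ P) φ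

theorem derives_andAll_iff {Γ : Set (Form V)} {φ : Form V} {L : List (Form V)} :
    Derives Γ (φ.andAll L) ↔ Derives Γ φ ∧ ∀ P ∈ L, Derives Γ P := by
  induction L with
  | nil => simp [Form.andAll]
  | cons P L ih =>
    change Derives Γ (.and (φ.andAll L) P) ↔ _
    rw [List.forall_mem_cons]
    constructor
    · intro h
      have := ih.1 h.andE₁
      exact ⟨this.1, h.andE₂, this.2⟩
    · exact fun h => .andI (ih.2 ⟨h.1, h.2.2⟩) h.2.1

/-- Elimination of several primitive inclusion atoms inside a disjunct. -/
theorem Derives.orInclElim {Γ : Set (Form V)} {φ ψ χ : Form V} {L : List (Form V)}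
    (hL : ∀ P ∈ L, ∃ (k : ℕ) (x : Fin k → Bool) (a : Fin k → Arg V), P = .primIncl x a)
    (h : Derives Γ (.or (φ.andAll L) ψ))
    (h₁ : ∀ Γ', Γ ⊆ Γ' → Derives Γ' (.or φ ψ) → (∀ P ∈ L, Derives Γ' P) → Derives Γ' χ)
    (h₂ : ∀ Γ', Γ ⊆ Γ' → Derives Γ' ψ → Derives Γ' χ) : Derives Γ χ := by
  induction L generalizing Γ with
  | nil => exact h₁ Γ subset_rfl h (by simp)
  | cons P L ih =>
    rw [List.forall_mem_cons] at hL
    obtain ⟨⟨k, x, a, rfl⟩, hL⟩ := hL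
    -- This serves two subderivations of `orInclE`, since the left disjunct alone gives the
    -- disjunction by `orI₁`.
    have key : ∀ Γ', Γ ⊆ Γ' → Derives Γ' (.primIncl x a) → Derives Γ' (.or (φ.andAll L) ψ) →
        Derives Γ' χ := by
      intro Γ' hΓ hP hor
      refine ih hL hor (fun Γ'' hs hor hL' => h₁ Γ'' (hΓ.trans hs) hor ?_)
        fun Γ'' hs => h₂ Γ'' (hΓ.trans hs)
      rw [List.forall_mem_cons]
      exact ⟨hP.mono hs, hL'⟩
    have hs : ∀ φ ψ : Form V, Γ ⊆ insert φ (insert ψ Γ) :=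
      fun _ _ _ h => Set.mem_insert_of_mem _ (Set.mem_insert_of_mem _ h)
    exact .orInclE h (key _ (hs _ _) Derives.head.weaken (.orI₁ .head))
      (h₂ _ (Set.subset_insert _ _) .head) (key _ (hs _ _) Derives.head.weaken .head)

theorem Form.incl_vars {N : Set V} {k : ℕ} {a b : Fin k → Arg V} (h : (Form.incl a b).vars ⊆ N) :
    (∀ i, (a i).vars ⊆ N) ∧ ∀ i, (b i).vars ⊆ N :=
  ⟨fun i => (Set.subset_iUnion (fun i => (a i).vars) i).trans (Set.subset_union_left.trans h),
    fun i => (Set.subset_iUnion (fun i => (b i).vars) i).trans (Set.subset_union_right.trans h)⟩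

section NormalForm

variable {N : Set V} [Finite N]

variable (N) in
/-- The sequence of all variables of a finite domain. -/
noncomputable def domArgs : Fin (Nat.card N) → Arg V :=
  fun i => .var ((Finite.equivFin N).symm i).1

/-- The sequence of values of a valuation. -/
noncomputable def Valuation.tuple (v : Valuation N) : Fin (Nat.card N) → Bool :=
  fun i => v ((Finite.equivFin N).symm i)

/-- The classical formula that describes a valuation. -/
noncomputable def Valuation.char (v : Valuation N) : CForm V := seqPow (domArgs N) v.tuple

/-- The primitive inclusion atom that says that a nonempty team contains the valuation. -/
noncomputable def Valuation.atom (v : Valuation N) : Form V := .primIncl v.tuple (domArgs N)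

theorem Valuation.holds_char {v : Valuation N} {f : V → Bool} :
    v.char.Holds f ↔ ∀ p : N, f p = v p := by
  rw [char, holds_seqPow]
  constructor
  · intro h p
    obtain ⟨i, rfl⟩ := (Finite.equivFin N).symm.surjective p
    exact h i
  · exact fun h i => h _

theorem Valuation.holds_of_char {v : Valuation N} {f : V → Bool} {α : CForm V}
    (hα : α.vars ⊆ N) (h : v.char.Holds f) : α.Holds f ↔ α.Holds v.ext := by
  refine CForm.holds_congr fun p hp => ?_
  exact (holds_char.1 h ⟨p, hα hp⟩).trans (ext_coe v ⟨p, hα hp⟩).symm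

theorem Valuation.val_of_char {v : Valuation N} {f : V → Bool} {a : Arg V}
    (ha : a.vars ⊆ N) (h : v.char.Holds f) : a.eval f = a.val v := by
  cases a with
  | var p => rw [Arg.val_eq_eval]; exact (holds_char.1 h ⟨p, ha rfl⟩).trans (ext_coe v ⟨p, _⟩).symm
  | top => rfl
  | bot => rfl

/-- The classical formula that describes the subteams of `X`. -/
noncomputable def theta (X : Finset (Valuation N)) : CForm V :=
  .disj (X.toList.map Valuation.char)

/-- The formula satisfied by exactly `X` and the empty team. -/
noncomputable def psi (X : Finset (Valuation N)) : Form V :=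
  (theta X).toForm.andAll (X.toList.map Valuation.atom)

theorem holds_theta {X : Finset (Valuation N)} {f : V → Bool} :
    (theta X).Holds f ↔ ∃ v ∈ X, v.char.Holds f := by
  simp [theta, CForm.holds_disj]

theorem derives_psi_iff {Γ : Set (Form V)} {X : Finset (Valuation N)} :
    Derives Γ (psi X) ↔ Derives Γ (theta X).toForm ∧ ∀ v ∈ X, Derives Γ v.atom := by
  simp [psi, derives_andAll_iff]

theorem atoms_primIncl (X : Finset (Valuation N)) : ∀ P ∈ X.toList.map Valuation.atom,
    ∃ (k : ℕ) (x : Fin k → Bool) (a : Fin k → Arg V), P = .primIncl x a := by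
  rw [List.forall_mem_map]
  exact fun v _ => ⟨_, _, _, rfl⟩

theorem derives_theta_congr {Γ : Set (Form V)} {X : Finset (Valuation N)} {α : CForm V}
    (hα : α.vars ⊆ N) (hX : ∀ v ∈ X, α.Holds v.ext) (h : Derives Γ (theta X).toForm) :
    Derives Γ α.toForm :=
  h.classical fun f hf => by
    obtain ⟨v, hv, hf⟩ := holds_theta.1 hf
    exact (Valuation.holds_of_char hα hf).2 (hX v hv)

/-- A disjunction of formulas `psi X` with `X` in a family that is closed under unions can be
eliminated in favour of a single one. -/
theorem Derives.psiElim [DecidableEq (Valuation N)] {K : Finset (Valuation N) → Prop}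
    (hK : ∀ X Y, K X → K Y → K (X ∪ Y)) {T : List (Finset (Valuation N))}
    (hT : ∀ X ∈ T, K X) {Γ : Set (Form V)} {W : Finset (Valuation N)} (hW : K W) {χ : Form V}
    (h : Derives Γ (.or (theta W).toForm (.disj (T.map psi))))
    (hWa : ∀ v ∈ W, Derives Γ v.atom)
    (hχ : ∀ Y Γ', Γ ⊆ Γ' → K Y → Derives Γ' (psi Y) → Derives Γ' χ) : Derives Γ χ := by
  -- `W` is the union of the teams absorbed so far: its atoms are derived outright, while `theta W`
  -- is still a disjunct. For the next team `X`, `orInclElim` either releases its atoms, and `W`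
  -- becomes `W ∪ X`, or drops `X`.
  induction T generalizing Γ W with
  | nil =>
    exact hχ W Γ subset_rfl hW (derives_psi_iff.2 ⟨h.orElim (.self _) (exFalso (.self _)), hWa⟩)
  | cons X T ih =>
    rw [List.forall_mem_cons] at hT
    have h' : Derives Γ (.or (psi X) (.or (theta W).toForm (.disj (T.map psi)))) :=
      h.orElim (.orI₂ (.orI₁ (.self _)))
        (orMap (φ := psi X) (ψ := .disj (T.map psi)) (.self _) (.self _) (.orI₂ (.self _)))
    refine orInclElim (atoms_primIncl X) h' (fun Γ' hΓ hor hL => ?_) fun Γ' hΓ hor => ?_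
    · rw [List.forall_mem_map] at hL
      refine ih hT.2 (hK W X hW hT.1) ?_ ?_ fun Y Γ'' hs => hχ Y Γ'' (hΓ.trans hs)
      · have hsub : ∀ Z, Z ⊆ W ∪ X → Derives {(theta Z).toForm} (theta (W ∪ X)).toForm :=
          fun Z hZ => derives_singleton_of_holds fun f hf => by
            obtain ⟨v, hv, hf⟩ := holds_theta.1 hf
            exact holds_theta.2 ⟨v, hZ hv, hf⟩
        exact hor.orElim (.orI₁ (hsub X Finset.subset_union_right))
          (orMap (.self _) (hsub W Finset.subset_union_left) (.self _))
      · intro v hv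
        rcases Finset.mem_union.1 hv with hv | hv
        exacts [(hWa v hv).mono hΓ, hL v (Finset.mem_toList.2 hv)]
    · exact ih hT.2 hW hor (fun v hv => (hWa v hv).mono hΓ) fun Y Γ'' hs => hχ Y Γ'' (hΓ.trans hs)

theorem Derives.psi_singleton (v : Valuation N) : Derives {v.char.toForm} (psi {v}) := by
  refine derives_psi_iff.2 ⟨derives_singleton_of_holds fun f hf => holds_theta.2 ⟨v, by simp, hf⟩,
    fun u hu => ?_⟩
  obtain rfl := Finset.mem_singleton.1 hu
  exact primIncl_of_pow fun i => derives_singleton_of_holds fun f hf =>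
    Arg.holds_pow.2 (holds_seqPow.1 hf i)

/-- Case distinction on the team. -/
theorem Derives.of_psi {Γ : Set (Form V)} {χ : Form V}
    (h : ∀ X : Finset (Valuation N), Derives (insert (psi X) Γ) χ) : Derives Γ χ := by
  classical
  have := Fintype.ofFinite (Valuation N)
  have hu : Derives Γ (theta (Finset.univ : Finset (Valuation N))).toForm :=
    .taut fun f => holds_theta.2 ⟨fun p => f p, Finset.mem_univ _,
      Valuation.holds_char.2 fun _ => rfl⟩
  -- The full `theta` is a tautology. Each of its disjuncts strengthens to the description of a
  -- singleton, and these are merged starting from `W = ∅`.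
  refine psiElim (K := fun _ => True) (fun _ _ _ _ => trivial)
    (T := (Finset.univ : Finset (Valuation N)).toList.map fun v => {v}) (fun _ _ => trivial)
    (W := ∅) trivial (.orI₂ ?_) (by simp) fun Y Γ' hΓ _ hY => hY.cut ?_
  · rw [theta, CForm.toForm_disj] at hu
    refine hu.disjE ?_
    simp only [List.forall_mem_map]
    intro v hv
    exact disjI (List.mem_map.2 ⟨{v}, List.mem_map.2 ⟨v, hv, rfl⟩, rfl⟩) (psi_singleton v)
  · exact (h Y).mono (Set.insert_subset_insert hΓ)

/-- Characteristic formulas of distinct valuations exclude each other, so `theta X` refutes that of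
`v`, against the atom. -/
theorem Derives.bot_of_atom {Γ : Set (Form V)} {X : Finset (Valuation N)} {v : Valuation N}
    (h : Derives Γ (theta X).toForm) (hv : v ∉ X) (ha : Derives Γ v.atom) : Derives Γ .bot := by
  refine ha.bot_of_primIncl (h.classical (α := .neg v.char) fun f hf hf' => ?_)
  obtain ⟨u, hu, hf⟩ := holds_theta.1 hf
  refine hv ?_
  convert hu
  funext p
  rw [← Valuation.holds_char.1 hf', Valuation.holds_char.1 hf]

theorem Derives.bot_of_psi_ne {Γ : Set (Form V)} {X Y : Finset (Valuation N)} (hne : X ≠ Y)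
    (hX : Derives Γ (psi X)) (hY : Derives Γ (psi Y)) : Derives Γ .bot := by
  rw [derives_psi_iff] at hX hY
  by_cases h : X ⊆ Y
  · obtain ⟨v, hv, hv'⟩ := Finset.not_subset.1 fun h' => hne (h.antisymm h')
    exact bot_of_atom hX.1 hv' (hY.2 v hv)
  · obtain ⟨v, hv, hv'⟩ := Finset.not_subset.1 h
    exact bot_of_atom hY.1 hv' (hX.2 v hv)

/-- From `v ⊆ N` derive `v(b) ⊆ b`, for arguments `b` over `N`. -/
theorem Derives.primIncl_of_atom {Γ : Set (Form V)} {v : Valuation N} (h : Derives Γ v.atom)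
    {k : ℕ} {b : Fin k → Arg V} (hb : ∀ i, (b i).vars ⊆ N) :
    Derives Γ (.primIncl (fun i => (b i).val v) b) := by
  rw [Valuation.atom, Form.primIncl, ← Form.inclList_ofFn] at h
  rw [Form.primIncl, ← Form.inclList_ofFn]
  -- A variable of `b` lies in the domain, so its column occurs in the atom; a constant gives a
  -- trivial column.
  refine h.inclList_of_subset ?_
  rw [List.forall_mem_ofFn_iff]
  intro i
  cases hbi : b i with
  | top => exact .inr ⟨true, rfl⟩
  | bot => exact .inr ⟨false, rfl⟩
  | var p =>
    have hp : p ∈ N := hb i (hbi ▸ rfl)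
    obtain ⟨j, hj⟩ := (Finite.equivFin N).symm.surjective ⟨p, hp⟩
    refine .inl (List.mem_ofFn.2 ⟨j, ?_⟩)
    rw [Valuation.tuple, domArgs, hj, Arg.val, dif_pos hp]

theorem seqPow_not_holds {f : V → Bool} {v : Valuation N} {k : ℕ} {a : Fin k → Arg V}
    {x : Fin k → Bool} (ha : ∀ i, (a i).vars ⊆ N) (hf : v.char.Holds f)
    (hx : ¬ ∀ i, (a i).val v = x i) : ¬ (seqPow a x).Holds f := by
  rw [holds_seqPow]
  intro h
  exact hx fun i => by rw [← Valuation.val_of_char (ha i) hf, h]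

/-! ### Deriving and refuting formulas from the description of a team -/

theorem Derives.conjI {Γ : Set (Form V)} {L : List (Form V)} (h : ∀ φ ∈ L, Derives Γ φ) :
    Derives Γ (.conj L) := by
  induction L with
  | nil => exact .topI
  | cons φ L ih =>
    rw [List.forall_mem_cons] at h
    cases L with
    | nil => exact h.1
    | cons ψ L => exact .andI h.1 (ih h.2)

theorem Derives.of_foldl_and {Γ : Set (Form V)} {L : List (PrimAtom V)} {φ : Form V}
    (h : Derives Γ (L.foldl (fun χ P => .and χ P.toForm) φ)) :
    Derives Γ φ ∧ ∀ P ∈ L, Derives Γ P.toForm := by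
  induction L generalizing φ with
  | nil => exact ⟨h, by simp⟩
  | cons P L ih =>
    obtain ⟨h₁, h₂⟩ := ih (φ := .and φ P.toForm) h
    exact ⟨h₁.andE₁, List.forall_mem_cons.2 ⟨h₁.andE₂, h₂⟩⟩

theorem foldl_or_toForm (L : List (PrimAtom V)) (α : CForm V) :
    L.foldl (fun χ P => Form.or χ P.power.toForm) α.toForm =
      (L.foldl (fun χ P => CForm.or χ P.power) α).toForm := by
  induction L generalizing α with
  | nil => rfl
  | cons P L ih => exact ih (.or α P.power)

theorem holds_foldl_or {f : V → Bool} {L : List (PrimAtom V)} {α : CForm V} :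
    (L.foldl (fun χ P => CForm.or χ P.power) α).Holds f ↔
      α.Holds f ∨ ∃ P ∈ L, P.power.Holds f := by
  induction L generalizing α with
  | nil => simp
  | cons P L ih =>
    simp only [List.foldl_cons, ih, CForm.Holds, List.mem_cons, exists_eq_or_imp, or_assoc]

/-- The inclusion atoms for the members of `X` can be moved into a disjunct `theta X`. -/
theorem Derives.psi_or {Γ : Set (Form V)} {X : Finset (Valuation N)} {ψ : Form V}
    (h : Derives Γ (.or (theta X).toForm ψ)) (hX : ∀ v ∈ X, Derives Γ v.atom) :
    Derives Γ (.or (psi X) ψ) := by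
  let L : List (PrimAtom V) := X.toList.map fun v => ⟨_, v.tuple, domArgs N⟩
  have hL : ∀ Γ, (∀ P ∈ L, Derives Γ P.toForm) ↔ ∀ v ∈ X, Derives Γ v.atom := fun Γ => by
    simp only [L, List.forall_mem_map, Finset.mem_toList]
    rfl
  have hd : Derives Γ (.dst (theta X).toForm ψ L) := .inclDst h ((hL Γ).2 hX)
  refine hd.orMap (derives_psi_iff.2 ?_) (.self _)
  obtain ⟨h₁, h₂⟩ := of_foldl_and (.self _)
  refine ⟨?_, (hL _).1 h₂⟩
  rw [foldl_or_toForm] at h₁ ⊢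
  -- The powers added by `inclDst` are characteristic formulas of members of `X`, hence absorbed by
  -- `theta X`.
  refine h₁.classical fun f hf => ?_
  rcases holds_foldl_or.1 hf with hf | ⟨P, hP, hf⟩
  · exact hf
  · obtain ⟨v, hv, rfl⟩ := List.mem_map.1 hP
    exact holds_theta.2 ⟨v, Finset.mem_toList.1 hv, hf⟩

theorem Derives.psi_classical {X : Finset (Valuation N)} {α : CForm V} (hα : α.vars ⊆ N)
    (h : ∀ v ∈ X, α.Holds v.ext) : Derives {psi X} α.toForm :=
  derives_theta_congr hα h (derives_psi_iff.1 (.self _)).1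

/-- A satisfied formula is derivable from the description of the team. -/
theorem derives_of_sat {φ : Form V} {X : Finset (Valuation N)} (hN : φ.vars ⊆ N)
    (h : φ.Sat (X : Set (Valuation N))) : Derives {psi X} φ := by
  induction φ generalizing X with
  | var p => exact .psi_classical (α := .var p) hN h
  | bot =>
    have h : (X : Set (Valuation N)) = ∅ := h
    exact .psi_classical (α := .bot) hN fun v hv =>
      (h ▸ (Finset.mem_coe.2 hv) : v ∈ (∅ : Set (Valuation N))).elim
  | top => exact .topI
  | neg α => exact .psi_classical (α := .neg α) hN (Form.neg_sat_iff.1 h)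
  | and φ ψ ih₁ ih₂ =>
    exact .andI (ih₁ (Set.subset_union_left.trans hN) h.1)
      (ih₂ (Set.subset_union_right.trans hN) h.2)
  | or φ ψ ih₁ ih₂ =>
    obtain ⟨Y, Z, -, -, hX, hY, hZ⟩ := h
    lift Y to Finset (Valuation N) using Set.toFinite Y
    lift Z to Finset (Valuation N) using Set.toFinite Z
    obtain ⟨hθ, ha⟩ := derives_psi_iff.1 (Derives.self (psi X))
    have hmem : ∀ v, v ∈ X ↔ v ∈ Y ∨ v ∈ Z := fun v => Set.ext_iff.1 hX v
    -- `theta X` splits along `X = Y ∪ Z`. All atoms for `Y` and `Z` follow from `psi X` and are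
    -- moved into the disjuncts, one side at a time.
    have h₀ : Derives {psi X} (.or (theta Y).toForm (theta Z).toForm) :=
      hθ.classical (α := .or (theta Y) (theta Z)) fun f hf => by
        obtain ⟨v, hv, hf⟩ := holds_theta.1 hf
        exact ((hmem v).1 hv).imp (fun h => holds_theta.2 ⟨v, h, hf⟩)
          fun h => holds_theta.2 ⟨v, h, hf⟩
    have h₁ := h₀.psi_or fun v hv => ha v ((hmem v).2 (.inl hv))
    have h₂ := h₁.orSwap.psi_or fun v hv => ha v ((hmem v).2 (.inr hv))
    exact h₂.orSwap.orMap (ih₁ (Set.subset_union_left.trans hN) hY)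
      (ih₂ (Set.subset_union_right.trans hN) hZ)
  | incl a b =>
    obtain ⟨hθ, hat⟩ := derives_psi_iff.1 (Derives.self (psi X))
    obtain ⟨ha, hb⟩ := Form.incl_vars hN
    refine .inclExt (.conjI ?_)
    rw [List.forall_mem_map]
    intro x _
    -- If `x` is a value of `a` on `X`, a semantic witness supplies `x ⊆ b`; otherwise `theta X`
    -- refutes `a ^ x`.
    by_cases hx : ∃ v ∈ X, ∀ i, (a i).val v = x i
    · obtain ⟨v, hv, hx⟩ := hx
      obtain ⟨u, hu, hvu⟩ := h v hv
      obtain rfl : (fun i => (b i).val u) = x := funext fun i => by rw [← hvu, hx]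
      exact .orI₂ ((hat u hu).primIncl_of_atom hb)
    · refine .orI₁ (hθ.classical (α := .neg (seqPow a x)) fun f hf => ?_)
      obtain ⟨v, hv, hf⟩ := holds_theta.1 hf
      exact seqPow_not_holds ha hf fun h => hx ⟨v, hv, h⟩

theorem Derives.bot_of_classical {Γ : Set (Form V)} {X : Finset (Valuation N)} {α : CForm V}
    (hα : α.vars ⊆ N) (hX : ¬ ∀ v ∈ X, α.Holds v.ext) (h : Derives Γ α.toForm)
    (hψ : Derives Γ (psi X)) : Derives Γ .bot := by
  push Not at hX
  obtain ⟨v, hv, hv'⟩ := hX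
  exact ((derives_psi_iff.1 hψ).2 v hv).bot_of_primIncl
    (h.classical (α := .neg v.char) fun f hf hf' =>
      hv' ((Valuation.holds_of_char hα hf').1 hf))

/-- A formula that is not satisfied is inconsistent with the description of the team. -/
theorem Derives.bot_of_not_sat {φ : Form V} {X : Finset (Valuation N)} (hN : φ.vars ⊆ N)
    (h : ¬ φ.Sat (X : Set (Valuation N))) {Γ : Set (Form V)} (hφ : Derives Γ φ)
    (hX : Derives Γ (psi X)) : Derives Γ .bot := by
  induction φ generalizing X Γ with
  | var p => exact bot_of_classical (α := .var p) hN h hφ hX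
  | bot => exact hφ
  | top => exact (h trivial).elim
  | neg α => exact bot_of_classical (α := .neg α) hN (fun h' => h (Form.neg_sat_iff.2 h')) hφ hX
  | and φ ψ ih₁ ih₂ =>
    rcases not_and_or.1 h with h | h
    · exact ih₁ (Set.subset_union_left.trans hN) h hφ.andE₁ hX
    · exact ih₂ (Set.subset_union_right.trans hN) h hφ.andE₂ hX
  | or φ ψ ih₁ ih₂ =>
    classical
    have := Fintype.ofFinite (Valuation N)
    -- Case distinction on teams and the induction hypotheses reduce each disjunct to descriptions
    -- of teams in `K`. As `K` is closed under unions, `psiElim` leaves a single `psi Y` with `K Y`;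
    -- it contradicts `psi X`, since `K X` fails.
    let K : Finset (Valuation N) → Prop := fun Y => (Form.or φ ψ).Sat (Y : Set (Valuation N))
    let T : List (Finset (Valuation N)) := (Finset.univ.filter K).toList
    have hT : ∀ Y, Y ∈ T ↔ K Y := by simp [T]
    have key : ∀ χ : Form V, χ.vars ⊆ N →
        (∀ (X : Finset (Valuation N)), ¬ χ.Sat (X : Set (Valuation N)) →
          ∀ {Γ : Set (Form V)}, Derives Γ χ → Derives Γ (psi X) → Derives Γ .bot) →
        (∀ Y : Finset (Valuation N), χ.Sat (Y : Set (Valuation N)) → K Y) →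
        Derives {χ} (.disj (T.map psi)) := by
      intro χ hχ ih hK
      refine .of_psi (N := N) fun Y => ?_
      by_cases hY : χ.Sat (Y : Set (Valuation N))
      · exact disjI (List.mem_map.2 ⟨Y, (hT Y).2 (hK Y hY), rfl⟩) .head
      · exact exFalso (ih Y hY (Derives.self χ).weaken .head)
    refine psiElim (K := K) (fun Y Z hY hZ => ?_) (fun Y hY => (hT Y).1 hY) (W := ∅) ?_
      (.orI₂ (hφ.orElim (key φ (Set.subset_union_left.trans hN)
        (fun X h _ => ih₁ (Set.subset_union_left.trans hN) h) fun Y hY => ?_)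
        (key ψ (Set.subset_union_right.trans hN)
        (fun X h _ => ih₂ (Set.subset_union_right.trans hN) h) fun Y hY => ?_)))
      (by simp) fun Y Γ' hΓ hY hY' => bot_of_psi_ne (by rintro rfl; exact h hY) hY' (hX.mono hΓ)
    · have := hY.union hZ
      rwa [← Finset.coe_union] at this
    · change (Form.or φ ψ).Sat _
      rw [Finset.coe_empty]
      exact Form.sat_empty _
    · exact Form.sat_or (Set.union_empty _).symm hY (Form.sat_empty _)
    · exact Form.sat_or (Set.empty_union _).symm (Form.sat_empty _) hY
  | incl a b =>
    obtain ⟨hθ, hat⟩ := derives_psi_iff.1 hX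
    obtain ⟨ha, hb⟩ := Form.incl_vars hN
    simp only [Form.Sat, Finset.mem_coe] at h
    push Not at h
    obtain ⟨v, hv, h⟩ := h
    -- The value of `a` at `v` is carried over to `b` by transitivity, but no member of `X` gives
    -- `b` this value.
    have h₁ : Derives Γ (.primIncl (fun i => (a i).val v) b) :=
      .inclTrs ((hat v hv).primIncl_of_atom ha) hφ
    refine h₁.bot_of_primIncl (hθ.classical (α := .neg (seqPow b _)) fun f hf => ?_)
    obtain ⟨u, hu, hf⟩ := holds_theta.1 hf
    obtain ⟨i, hi⟩ := h u hu
    exact seqPow_not_holds hb hf fun h => hi (h i).symm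

/-- Completeness over a finite domain. -/
theorem derives_of_finite_domain {Γ : Set (Form V)} {φ : Form V} (hΓ : ∀ γ ∈ Γ, γ.vars ⊆ N)
    (hφ : φ.vars ⊆ N) (h : ∀ X : Team N, (∀ γ ∈ Γ, γ.Sat X) → φ.Sat X) : Derives Γ φ := by
  refine .of_psi (N := N) fun X => ?_
  by_cases hX : ∀ γ ∈ Γ, γ.Sat (X : Set (Valuation N))
  · exact Derives.head.trans (derives_of_sat hφ (h _ hX))
  · push Not at hX
    obtain ⟨γ, hγ, hX⟩ := hX
    exact .exFalso (.bot_of_not_sat (hΓ γ hγ) hX (.assumption (.inr hγ)) .head)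

end NormalForm

/-! ### Locality and compactness -/

theorem Form.finite_vars (φ : Form V) : φ.vars.Finite := by
  have ha : ∀ a : Arg V, a.vars.Finite := fun a => by cases a <;> simp [Arg.vars]
  induction φ with
  | var p => exact Set.finite_singleton p
  | bot => exact Set.finite_empty
  | top => exact Set.finite_empty
  | neg α => exact α.finite_vars
  | and φ ψ ih₁ ih₂ => exact ih₁.union ih₂
  | or φ ψ ih₁ ih₂ => exact ih₁.union ih₂
  | incl a b => exact (Set.finite_iUnion fun i => ha _).union (Set.finite_iUnion fun i => ha _)

/-- Satisfaction only depends on the values of the variables in the formula. -/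
theorem Form.sat_image_iff {N M : Set V} {g : Valuation N → Valuation M} {φ : Form V}
    (hg : ∀ p ∈ φ.vars, ∀ v, (g v).ext p = v.ext p) {X : Team N} :
    φ.Sat (g '' X) ↔ φ.Sat X := by
  induction φ generalizing X with
  | var p =>
    simp only [Sat, Set.forall_mem_image]
    exact forall₂_congr fun v _ => by rw [← Valuation.ext, ← Valuation.ext, hg p rfl]
  | bot => exact Set.image_eq_empty
  | top => rfl
  | neg α =>
    simp only [neg_sat_iff, Set.forall_mem_image]
    exact forall₂_congr fun v _ => not_congr (CForm.holds_congr fun p hp => hg p hp v)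
  | and φ ψ ih₁ ih₂ =>
    exact and_congr (ih₁ fun p hp => hg p (.inl hp)) (ih₂ fun p hp => hg p (.inr hp))
  | or φ ψ ih₁ ih₂ =>
    replace ih₁ := fun {X} => ih₁ (fun p hp => hg p (.inl hp)) (X := X)
    replace ih₂ := fun {X} => ih₂ (fun p hp => hg p (.inr hp)) (X := X)
    constructor
    · rintro ⟨Y, Z, hY, hZ, h, h₁, h₂⟩
      -- The map `g` need not be injective; full preimages within `X` split `X` and have the given
      -- halves as images.
      have e : ∀ W ⊆ g '' X, g '' (X ∩ g ⁻¹' W) = W := fun W hW => by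
        rw [Set.image_inter_preimage, Set.inter_eq_right.2 hW]
      refine sat_or ?_ (ih₁.1 ((e Y hY).symm ▸ h₁)) (ih₂.1 ((e Z hZ).symm ▸ h₂))
      rw [← Set.inter_union_distrib_left, ← Set.preimage_union, ← h]
      exact (Set.inter_eq_left.2 (Set.subset_preimage_image g X)).symm
    · rintro ⟨Y, Z, -, -, rfl, h₁, h₂⟩
      exact sat_or (Set.image_union g Y Z) (ih₁.2 h₁) (ih₂.2 h₂)
  | incl a b =>
    have hv : ∀ c : Arg V, c.vars ⊆ (Form.incl a b).vars → ∀ v, c.val (g v) = c.val v := by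
      intro c hc v
      cases c with
      | var p => exact hg p (hc rfl) v
      | top => rfl
      | bot => rfl
    obtain ⟨ha, hb⟩ := incl_vars (N := (Form.incl a b).vars) (subset_refl _)
    simp only [Sat, Set.forall_mem_image, Set.exists_mem_image, hv _ (ha _), hv _ (hb _)]

/-- The restriction of a valuation of all variables. -/
def Valuation.restrict (N : Set V) (v : Valuation (Set.univ : Set V)) : Valuation N :=
  fun p => v ⟨p, trivial⟩

theorem Form.sat_restrict_iff {N : Set V} {φ : Form V} (hN : φ.vars ⊆ N)
    {X : Team (Set.univ : Set V)} : φ.Sat (Valuation.restrict N '' X) ↔ φ.Sat X := by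
  refine sat_image_iff fun p hp v => ?_
  rw [Valuation.ext_coe _ ⟨p, hN hp⟩, Valuation.ext_coe v ⟨p, trivial⟩]
  rfl

/-- The extension of a valuation as a valuation of all variables. -/
noncomputable def Valuation.extend {N : Set V} (v : Valuation N) :
    Valuation (Set.univ : Set V) := fun p => v.ext p

theorem Form.sat_extend_iff {N : Set V} {φ : Form V} {X : Team N} :
    φ.Sat (Valuation.extend '' X) ↔ φ.Sat X :=
  sat_image_iff fun p _ v => Valuation.ext_coe v.extend ⟨p, trivial⟩

/-- The limit of a family of teams along an ultrafilter. -/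
def limTeam {ι : Type*} (U : Ultrafilter ι) (X : ι → Team (Set.univ : Set V)) :
    Team (Set.univ : Set V) :=
  {v | ∀ N : Set V, N.Finite → ∀ᶠ i in U, v.restrict N ∈ Valuation.restrict N '' X i}

/-- An analogue of Łoś's theorem. There are finitely many teams over the variables of `φ`, so the
restrictions of the `X i` equal one team `T` for almost all `i`. The limit team also restricts to
`T`, and locality does the rest. -/
theorem sat_limTeam_iff {ι : Type*} (U : Ultrafilter ι) (X : ι → Team (Set.univ : Set V))
    (φ : Form V) : φ.Sat (limTeam U X) ↔ ∀ᶠ i in U, φ.Sat (X i) := by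
  classical
  have := φ.finite_vars.to_subtype
  set N := φ.vars with hN
  obtain ⟨T, hT⟩ : ∃ T : Team N, ∀ᶠ i in U, Valuation.restrict N '' X i = T := by
    obtain ⟨T, hT⟩ := (U.map fun i => Valuation.restrict N '' X i).eq_pure_of_finite
    refine ⟨T, ?_⟩
    have : ({T} : Set (Team N)) ∈ U.map fun i => Valuation.restrict N '' X i := by
      rw [hT]
      exact Set.mem_singleton T
    exact this
  have hlim : Valuation.restrict N '' limTeam U X = T := by
    ext w
    constructor
    · rintro ⟨v, hv, rfl⟩
      obtain ⟨i, hi, rfl⟩ := ((hv N φ.finite_vars).and hT).exists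
      exact hi
    · intro hw
      have hu : ∀ᶠ i in U, ∃ u ∈ X i, u.restrict N = w := hT.mono fun i hi => by
        rw [← hi] at hw
        exact hw
      obtain ⟨u, hu⟩ : ∃ u : ι → Valuation (Set.univ : Set V),
          ∀ᶠ i in U, u i ∈ X i ∧ (u i).restrict N = w :=
        hu.choice
      -- The coordinatewise ultralimit of the chosen `u i`. On each finite set of variables it
      -- agrees with almost all of them, which puts it in the limit team.
      let v : Valuation (Set.univ : Set V) := fun p => decide (∀ᶠ i in U, u i p = true)
      have hv : ∀ p, ∀ᶠ i in U, u i p = v p := by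
        intro p
        by_cases h : ∀ᶠ i in U, u i p = true
        · simpa only [v, decide_eq_true h] using h
        · simpa only [v, decide_eq_false h, Bool.not_eq_true] using Ultrafilter.eventually_not.2 h
      have hM : ∀ M : Set V, M.Finite → ∀ᶠ i in U, (u i).restrict M = v.restrict M := by
        intro M hM
        have := hM.to_subtype
        have h : ∀ᶠ i in U, ∀ p : M, u i ⟨p, trivial⟩ = v ⟨p, trivial⟩ :=
          Filter.eventually_all.2 fun p => hv _
        exact h.mono fun i hi => funext hi
      refine ⟨v, fun M hMf => ?_, ?_⟩
      · filter_upwards [hM M hMf, hu] with i h₁ h₂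
        exact ⟨u i, h₂.1, h₁⟩
      · obtain ⟨i, h₁, h₂⟩ := ((hM N φ.finite_vars).and hu).exists
        exact h₁.symm.trans h₂.2
  rw [← Form.sat_restrict_iff hN.ge, hlim]
  constructor
  · intro h
    filter_upwards [hT] with i hi
    rwa [← Form.sat_restrict_iff hN.ge, hi]
  · intro h
    obtain ⟨i, h, rfl⟩ := (h.and hT).exists
    rwa [Form.sat_restrict_iff hN.ge]

/-- If `φ` is not derivable, completeness over finite domains gives a countermodel for each finite
part of `Γ`. Their limit satisfies all of `Γ` but not `φ`. -/
theorem Derives.of_entails {Γ : Set (Form V)} {φ : Form V} (h : Entails Γ φ) : Derives Γ φ := by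
  classical
  by_contra hn
  have hX : ∀ s : Finset Γ, ∃ X : Team (Set.univ : Set V),
      (∀ γ ∈ s, γ.1.Sat X) ∧ ¬ φ.Sat X := by
    intro s
    let Δ : Set (Form V) := Subtype.val '' (s : Set Γ)
    let N : Set V := (⋃ γ ∈ Δ, γ.vars) ∪ φ.vars
    have hfin : N.Finite :=
      ((s.finite_toSet.image _).biUnion fun γ _ => γ.finite_vars).union φ.finite_vars
    have := hfin.to_subtype
    by_contra! hs
    refine hn (mono (Γ := Δ) (derives_of_finite_domain (N := N) ?_ Set.subset_union_right
      fun X hX => ?_) (by rintro _ ⟨γ, -, rfl⟩; exact γ.2))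
    · exact fun γ hγ => (Set.subset_biUnion_of_mem (u := Form.vars) hγ).trans
        Set.subset_union_left
    · exact Form.sat_extend_iff.1 (hs _ fun γ hγ =>
        Form.sat_extend_iff.2 (hX _ ⟨γ, hγ, rfl⟩))
  choose X hX hX' using hX
  let U : Ultrafilter (Finset Γ) := .of Filter.atTop
  have hlim := h Set.univ (Set.subset_univ _) (limTeam U X) fun γ hγ => by
    rw [sat_limTeam_iff]
    -- The team `X s` satisfies `γ` as soon as `s` contains `γ`, and the ultrafilter refines
    -- `atTop`.
    have : ∀ᶠ s : Finset Γ in Filter.atTop, γ.Sat (X s) :=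
      (Filter.eventually_ge_atTop {⟨γ, hγ⟩}).mono fun s hs =>
        hX s ⟨γ, hγ⟩ (hs (Finset.mem_singleton_self _))
    exact this.filter_mono (Ultrafilter.of_le _)
  obtain ⟨s, hs⟩ := ((sat_limTeam_iff U X φ).1 hlim).exists
  exact hX' s hs

/-! ### Reduction of inclusion atoms to primitive ones -/

theorem isPrimitive_conj {L : List (Form V)} (h : ∀ φ ∈ L, φ.IsPrimitive) :
    (Form.conj L).IsPrimitive := by
  induction L with
  | nil => trivial
  | cons φ L ih =>
    rw [List.forall_mem_cons] at h
    cases L with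
    | nil => exact h.1
    | cons ψ L => exact ⟨h.1, ih h.2⟩

theorem isPrimitive_reduct {k : ℕ} (a b : Fin k → Arg V) : (Form.reduct a b).IsPrimitive := by
  refine isPrimitive_conj ?_
  rw [List.forall_mem_map]
  exact fun x _ => ⟨trivial, x, rfl⟩

theorem provEquiv_reduct {k : ℕ} (a b : Fin k → Arg V) :
    ProvEquiv (.incl a b) (.reduct a b) := by
  refine ⟨.conjI ?_, .inclExt (.self _)⟩
  rw [List.forall_mem_map]
  exact fun x _ => .inclRdt x (.self _)

end InclLogic

open InclLogic in
theorem mainTheorem4 {V : Type*} :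
    (∀ (Γ : Set (Form V)) (φ : Form V), Entails Γ φ ↔ Derives Γ φ) ∧
    (∀ (k : ℕ) (a b : Fin k → Arg V),
      (Form.reduct a b).IsPrimitive ∧
      SemEquiv (.incl a b) (.reduct a b) ∧
      ProvEquiv (.incl a b) (.reduct a b)) := by
  refine ⟨fun Γ φ => ⟨.of_entails, Derives.entails⟩, fun k a b => ?_⟩
  have h := provEquiv_reduct a b
  exact ⟨isPrimitive_reduct a b, ⟨h.1.entails, h.2.entails⟩, h⟩
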